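/- Let $n\ge 2$ and let $C_{2n}=K_1\cup\dots\cup K_{2n}\subset\mathbb S^3$ be the minimally twisted $2n$-chain link: a closed chain of $2n$ unknotted circles, indexed cyclically mod $2n$, that lie alternately in the projection plane and perpendicular to it, each $K_j$ bounding a disk $D_j$ that meets the other components in one point of $K_{j-1}$ and one point of $K_{j+1}$. Let $A_i=D_i\setminus K_{i+1}$ and $A_{i+1}=D_{i+1}\setminus K_i$ (annuli). The $i$-th $ml$-swap $s_i$ is the composition of a right-handed Dehn twist along $A_i$, then a left-handed Dehn twist along $A_{i+1}$, then a right-handed Dehn twist along $A_i$; it is a self-homeomorphism of $\mathbb S^3\setminus(K_i\cup K_{i+1})$, and the link $C_{2n}'=s_i(C_{2n})$ that results from it has as components $K_i$, $K_{i+1}$ and the images $s_i(K_j)$, $j\ne i,i+1$. The swaps $s_i,s_j$ are non-overlapping if $|i-j|\ge 4$ mod $2n$. A non-overlapping nested partner of $C_{2n}$ is a link isotopic to the result of performing a finite sequence of pairwise non-overlapping $ml$-swaps on $C_{2n}$. For a sublink $L^*$ of a link $L=L_1\cup\dots\cup L_m\subset\mathbb S^3$, $0$-surgery on $L^*\subset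 L$ means: choose (smooth) closed tubular neighbourhoods $N_j$ of the components $L_j$, pairwise disjoint, with meridians and preferred (null-homologous in $\mathbb S^3\setminus L_j$) longitudes on $\partial N_j$; remove the interiors of all $N_j$, leaving the exterior $X$; glue in solid tori $V_j$ by homeomorphisms $\partial V_j\to\partial N_j$ that swap meridians and longitudes if $L_j\subset L^*$ and preserve meridians and longitudes otherwise. The result is a space $M'$ together with the link $L'\subset M'$ formed by the cores of the $V_j$. Such neighbourhoods exist for $L=C_{2n}$, and for every choice of them the following holds. (1) For every $i$ let $L'\subset M'$ be the link that results from $0$-surgery on $K_i\cup K_{i+1}\subset C_{2n}$. Then $M'=\mathbb S^3$ and $L'=C_{2n}'$, the link that results from the $ml$-swap $s_i$. Precisely: there is a homeomorphism $F:M'\to\mathbb S^3$ that coincides with $s_i$ on the exterior $X$ and takes the core of $V_j$ to the component $s_i(K_j)$ of $C'_{2n}$ for every $j$ (where $s_i(K_j)$ means $K_j$ if $j\in\{i,i+1\}$). (2) More generally, let $L$ be a non-overlapping nested partner of $C_{2n}$, created by the pairwise non-overlapping $ml$-swaps $s_{i_1},\dots,s_{i_m}$. Then $L$ is the result of $0$-surgery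 on the sublink $\bigcup_k(K_{i_k}\cup K_{i_k+1})\subset C_{2n}$. Precisely: there is a homeomorphism $F$ from the surgered space to $\mathbb S^3$ that takes the core of each $V_j$ to the corresponding component of $L$ and coincides on $X$ with $s_{i_1}\circ\dots\circ s_{i_m}$ followed by a homeomorphism of $\mathbb S^3$ isotopic to the identity. -/

import Mathlib

open scoped ContDiff

noncomputable section

/-! ### The three-sphere, isotopy of links -/

/-- The space `ℂ²` with its Euclidean norm. -/
abbrev C2 : Type := EuclideanSpace ℂ (Fin 2)

/-- The three-sphere: the unit sphere of `ℂ²`, with the orientation as the boundary of the unit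
ball. -/
abbrev S3 : Type := Metric.sphere (0 : C2) 1

/-- `Φ` is the end of an isotopy of `S³` that starts at the identity. -/
def IsotopicToId (Φ : S3 ≃ₜ S3) : Prop :=
  ∃ h : unitInterval → (S3 ≃ₜ S3),
    Continuous (fun p : unitInterval × S3 => h p.1 p.2) ∧ h 0 = Homeomorph.refl S3 ∧ h 1 = Φ

/-- A link is given by the family of its components. Two links with components indexed by `ι` are
isotopic if an ambient isotopy carries each component to the component with the same index. -/
def LinkIsotopic {ι : Type} (K L : ι → Set S3) : Prop :=
  ∃ Φ : S3 ≃ₜ S3, IsotopicToId Φ ∧ ∀ j, Φ '' K j = L j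

/-! ### Framed tubular neighbourhoods and 0-surgery on a sublink -/

/-- The loop `γ` lies in `U` and is null-homologous there: its class in the first homology group
of `U`, that is, in the abelianized fundamental group, is trivial. -/
def NullHomologousIn (U : Set S3) (γ : Circle → S3) : Prop :=
  ∃ (x : U) (p : Path x x), (∀ t : unitInterval, (p t : S3) = γ (Circle.exp (2 * Real.pi * t))) ∧
    Abelianization.of (FundamentalGroup.fromPath (Path.Homotopic.Quotient.mk p)) = 1

/-- A system of tubular neighbourhoods of the components of a link, each parametrized by
`ℝ² × S¹` (with `ℝ² = ℂ`) so that `{0} × S¹` is the component and `{1} × S¹` is a preferred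
longitude. The closed tubes, the images of `D² × S¹`, are disjoint. On the boundary torus of the
`j`-th closed tube, `u ↦ tube j (u, v)` is a meridian and `v ↦ tube j (u, v)` is a preferred
longitude. -/
structure TubeSystem {ι : Type} (K : ι → Set S3) where
  tube : ι → ℂ × Circle → S3
  smooth : ∀ j, ContDiff ℝ ∞ (fun y : ℂ × ℝ => (tube j (y.1, Circle.exp y.2) : C2))
  immersion : ∀ j y, Function.Injective
    (fderiv ℝ (fun y : ℂ × ℝ => (tube j (y.1, Circle.exp y.2) : C2)) y)
  injective : ∀ j, Function.Injective (tube j)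
  core : ∀ j, Set.range (fun v : Circle => tube j (0, v)) = K j
  disjoint : ∀ j k, j ≠ k →
    Disjoint (tube j '' (Metric.closedBall 0 1 ×ˢ Set.univ))
      (tube k '' (Metric.closedBall 0 1 ×ˢ Set.univ))
  preferred : ∀ j, NullHomologousIn (K j)ᶜ (fun v : Circle => tube j (1, v))

/-- The exterior of the link: the complement of the interiors of the closed tubes. -/
def TubeSystem.exterior {ι : Type} {K : ι → Set S3} (T : TubeSystem K) : Set S3 :=
  {x | ∀ j, x ∉ T.tube j '' (Metric.ball 0 1 ×ˢ Set.univ)}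

/-- The closed unit disk `D²`. -/
abbrev Disk : Type := Metric.closedBall (0 : ℂ) 1

/-- The boundary circle of `D²`. -/
def diskBoundary (u : Circle) : Disk := ⟨u, by simp [Circle.norm_coe]⟩

/-- The centre of `D²`. -/
def diskCentre : Disk := ⟨0, by simp⟩

/-- The gluing relation on the disjoint union of the exterior and of solid tori `V j = D² × S¹`.
If `j` is in the sublink `S` (label `0`), the gluing map of `∂ (V j)` swaps meridians and
longitudes; otherwise (label `∞`) it preserves meridians and longitudes. -/
inductive TubeSystem.Glue {ι : Type} {K : ι → Set S3} (T : TubeSystem K) (S : Set ι) :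
    (T.exterior ⊕ (Σ _ : ι, Disk × Circle)) → (T.exterior ⊕ (Σ _ : ι, Disk × Circle)) → Prop
  | swap (j : ι) (hj : j ∈ S) (u v : Circle) (x : T.exterior)
      (hx : (x : S3) = T.tube j ((v : ℂ), u)) :
      TubeSystem.Glue T S (Sum.inr ⟨j, diskBoundary u, v⟩) (Sum.inl x)
  | keep (j : ι) (hj : j ∉ S) (u v : Circle) (x : T.exterior)
      (hx : (x : S3) = T.tube j ((u : ℂ), v)) :
      TubeSystem.Glue T S (Sum.inr ⟨j, diskBoundary u, v⟩) (Sum.inl x)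

/-- The space that results from `0`-surgery on the sublink `S` (and `∞`-surgery on the other
components), with the quotient topology. -/
def TubeSystem.Surgery {ι : Type} {K : ι → Set S3} (T : TubeSystem K) (S : Set ι) : Type :=
  Quot (T.Glue S)

instance {ι : Type} {K : ι → Set S3} (T : TubeSystem K) (S : Set ι) :
    TopologicalSpace (T.Surgery S) :=
  inferInstanceAs (TopologicalSpace (Quot (T.Glue S)))

/-- The inclusion of the exterior in the surgered space. -/
def TubeSystem.ofExterior {ι : Type} {K : ι → Set S3} (T : TubeSystem K) (S : Set ι)
    (x : T.exterior) : T.Surgery S :=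
  Quot.mk _ (Sum.inl x)

/-- The link in the surgered space formed by the cores of the solid tori. -/
def TubeSystem.coreLink {ι : Type} {K : ι → Set S3} (T : TubeSystem K) (S : Set ι) (j : ι) :
    Set (T.Surgery S) :=
  Set.range (fun v : Circle => (Quot.mk _ (Sum.inr ⟨j, diskCentre, v⟩) : T.Surgery S))

/-! ### The minimally twisted chain link -/

/-- A complex function on `S³` whose zero set is the `k`-th component of the chain. Its argument
fibres the complement of that component by open disks. -/
def chainFun (n k : ℕ) (x : S3) : ℂ :=
  ⟨((x : C2) 0 * Complex.exp (-(k * Real.pi / n * Complex.I))).re - Real.cos (3 * Real.pi / (4 * n)),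
    ((x : C2) 1 * Complex.I ^ k).im⟩

/-- The minimally twisted `2n`-chain link. In coordinates `(z, w)` of `ℂ²`, the component `K j` is
the round circle of angular radius `3π/(4n)` about the point `e^{iπj/n}` of the axis `w = 0`, in
the two-sphere `w ∈ ℝ` for even `j` and in the two-sphere `w ∈ iℝ` for odd `j`; the two spheres
meet at right angles along the axis. (Stereographic projection from `(0, 1)` takes the first sphere
to the projection plane and the second one to the unit sphere, so the components with even `j` are
round circles in the projection plane and the others are round circles in vertical planes.)
It bounds the disk `D j` on which `chainFun` is real and nonnegative. -/
def chainLink (n : ℕ) (j : ZMod (2 * n)) : Set S3 := {x | chainFun n j.val x = 0}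

/-- A ray from a point inside an ellipsoid meets the ellipsoid exactly once. -/
theorem existsUnique_pos_root (A B C : ℝ) (hA : 0 < A) (hC : C < 0) :
    ∃! s : ℝ, 0 < s ∧ A * s ^ 2 + B * s + C = 0 := by
  have hD : B ^ 2 < B ^ 2 - 4 * A * C := by nlinarith
  set r := Real.sqrt (B ^ 2 - 4 * A * C) with hr
  have hr2 : r ^ 2 = B ^ 2 - 4 * A * C := Real.sq_sqrt (by nlinarith [sq_nonneg B])
  have hr0 : 0 ≤ r := Real.sqrt_nonneg _
  have hBr : B < r := by
    have h1 : B ^ 2 < r ^ 2 := hr2 ▸ hD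
    exact lt_of_le_of_lt (le_abs_self B) (abs_lt_of_sq_lt_sq h1 hr0)
  have hs0 : 0 < (-B + r) / (2 * A) := by apply div_pos <;> linarith
  refine ⟨(-B + r) / (2 * A), ⟨hs0, ?_⟩, ?_⟩
  · field_simp
    nlinarith
  · rintro t ⟨ht, h⟩
    have h1 : A * ((-B + r) / (2 * A)) ^ 2 + B * ((-B + r) / (2 * A)) + C = 0 := by
      field_simp
      nlinarith
    set s := (-B + r) / (2 * A)
    have h2 : (t - s) * (A * (t * s) - C) = 0 := by linear_combination s * h - t * h1
    rcases mul_eq_zero.1 h2 with h3 | h3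
    · linarith
    · nlinarith [mul_pos hA (mul_pos ht hs0)]

theorem chainFun_angles (n : ℕ) (hn : 2 ≤ n) :
    0 < Real.sin (Real.pi / n) ∧
    2 * Real.cos (3 * Real.pi / (4 * n)) ^ 2 < 1 + Real.cos (Real.pi / n) := by
  have hn' : (2 : ℝ) ≤ n := by exact_mod_cast hn
  have hpi := Real.pi_pos
  have ha : 0 < Real.pi / n := by positivity
  have ha2 : Real.pi / n ≤ Real.pi / 2 := by gcongr
  refine ⟨Real.sin_pos_of_pos_of_lt_pi ha (by linarith), ?_⟩
  have e : 3 * Real.pi / (4 * n) = 3 / 4 * (Real.pi / n) := by field_simp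
  rw [e]
  set a := Real.pi / n
  have h2 := Real.cos_sq (3 / 4 * a)
  have : Real.cos (2 * (3 / 4 * a)) < Real.cos a :=
    Real.cos_lt_cos_of_nonneg_of_le_pi (by linarith) (by linarith) (by linarith)
  linarith

/-- For `(p, q) ≠ 0` and `n ≥ 2` there is exactly one point of `S³` at which the functions of the
`k`-th and the `(k+1)`-st component have the values `s p` and `s q` for some `s > 0`. -/
theorem existsUnique_chainFun (n k : ℕ) (hn : 2 ≤ n) (p q : ℂ) (h : p ≠ 0 ∨ q ≠ 0) :
    ∃! y : S3, ∃ s : ℝ, 0 < s ∧ chainFun n k y = s * p ∧ chainFun n (k + 1) y = s * q := by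
  obtain ⟨hS, hc⟩ := chainFun_angles n hn
  set a := Real.pi / n with ha
  set r := Real.cos (3 * Real.pi / (4 * n)) with hr
  set e : ℂ := Complex.exp (-(k * Real.pi / n * Complex.I)) with he
  have hen : ‖e‖ = 1 := by
    have : e = Complex.exp (((-(k * Real.pi / n) : ℝ) : ℂ) * Complex.I) := by
      rw [he]; push_cast; ring_nf
    rw [this, Complex.norm_exp_ofReal_mul_I]
  have he0 : e ≠ 0 := Complex.exp_ne_zero _
  have hI0 : (Complex.I ^ k : ℂ) ≠ 0 := pow_ne_zero _ Complex.I_ne_zero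
  have hIn : ‖(Complex.I ^ k : ℂ)‖ = 1 := by simp
  have e1 : Complex.exp (-(((k + 1 : ℕ) : ℂ) * Real.pi / n * Complex.I)) =
      e * ((Real.cos a : ℂ) - Real.sin a * Complex.I) := by
    have : -(((k + 1 : ℕ) : ℂ) * Real.pi / n * Complex.I) =
        -(k * Real.pi / n * Complex.I) + ((-a : ℝ) : ℂ) * Complex.I := by
      rw [ha]; push_cast; ring
    rw [this, Complex.exp_add, Complex.exp_mul_I]
    rw [← Complex.ofReal_cos, ← Complex.ofReal_sin, Real.cos_neg, Real.sin_neg]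
    push_cast; ring
  set c := Real.cos a with hcd
  set S := Real.sin a with hSd
  have hcS : S ^ 2 + c ^ 2 = 1 := Real.sin_sq_add_cos_sq a
  -- the conditions on a point in rotated coordinates
  have key : ∀ (y : S3) (s : ℝ),
      (chainFun n k y = s * p ∧ chainFun n (k + 1) y = s * q) ↔
      (((y : C2) 0 * e).re = r + s * p.re ∧ ((y : C2) 0 * e).im * S = r + s * q.re -
        (r + s * p.re) * c ∧ ((y : C2) 1 * Complex.I ^ k).im = s * p.im ∧
        ((y : C2) 1 * Complex.I ^ k).re = s * q.im) := by
    intro y s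
    have f1 : chainFun n k y = ⟨((y : C2) 0 * e).re - r, ((y : C2) 1 * Complex.I ^ k).im⟩ := rfl
    have f2 : chainFun n (k + 1) y = ⟨((y : C2) 0 * e).re * c + ((y : C2) 0 * e).im * S - r,
        ((y : C2) 1 * Complex.I ^ k).re⟩ := by
      unfold chainFun
      rw [e1, ← mul_assoc, pow_succ, ← mul_assoc]
      apply Complex.ext
      · simp [Complex.mul_re, Complex.mul_im, hr]
      · simp [Complex.mul_im]
    rw [f1, f2]
    simp only [Complex.ext_iff, Complex.mul_re, Complex.mul_im, Complex.ofReal_re,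
      Complex.ofReal_im]
    constructor
    · rintro ⟨⟨h1, h2⟩, h3, h4⟩
      refine ⟨by linarith, ?_, by linarith, by linarith⟩
      have : ((y : C2) 0).re * e.re - ((y : C2) 0).im * e.im = r + s * p.re := by linarith
      rw [this] at h3
      linarith
    · rintro ⟨h1, h2, h3, h4⟩
      refine ⟨⟨by linarith, by linarith⟩, ?_, by linarith⟩
      rw [h1]
      linarith
  have hnorm : ∀ y : C2, ‖y‖ ^ 2 = (y 0 * e).re ^ 2 + (y 0 * e).im ^ 2 +
      ((y 1 * Complex.I ^ k).re ^ 2 + (y 1 * Complex.I ^ k).im ^ 2) := by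
    intro y
    have g : ∀ z : ℂ, z.re ^ 2 + z.im ^ 2 = ‖z‖ ^ 2 := fun z => by
      rw [← Complex.normSq_eq_norm_sq, Complex.normSq_apply]; ring
    rw [g, g, norm_mul, norm_mul, hen, hIn, mul_one, mul_one, EuclideanSpace.norm_sq_eq]
    simp
  clear_value e c S r
  -- the quadratic equation for the scale
  set A := S ^ 2 * (p.re ^ 2 + p.im ^ 2 + q.im ^ 2) + (q.re - p.re * c) ^ 2 with hA
  set B := 2 * (S ^ 2 * (r * p.re) + (r - r * c) * (q.re - p.re * c)) with hB
  set D := S ^ 2 * r ^ 2 + (r - r * c) ^ 2 - S ^ 2 with hD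
  have hA0 : 0 < A := by
    have hS2 : 0 < S ^ 2 := by positivity
    by_contra hneg
    have h0 : 0 ≤ S ^ 2 * (p.re ^ 2 + p.im ^ 2 + q.im ^ 2) := by positivity
    have h1 := sq_nonneg (q.re - p.re * c)
    have h2 : S ^ 2 * (p.re ^ 2 + p.im ^ 2 + q.im ^ 2) = 0 := by linarith
    have h3 : (q.re - p.re * c) ^ 2 = 0 := by linarith
    have h4 : p.re ^ 2 + p.im ^ 2 + q.im ^ 2 = 0 := (mul_eq_zero.1 h2).resolve_left hS2.ne'
    have p1 : p.re = 0 := by nlinarith [sq_nonneg p.re, sq_nonneg p.im, sq_nonneg q.im]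
    have p2 : p.im = 0 := by nlinarith [sq_nonneg p.re, sq_nonneg p.im, sq_nonneg q.im]
    have q2 : q.im = 0 := by nlinarith [sq_nonneg p.re, sq_nonneg p.im, sq_nonneg q.im]
    have q1 : q.re = 0 := by
      have := pow_eq_zero_iff (two_ne_zero) |>.1 h3
      rw [p1] at this; linarith
    rcases h with h | h
    · exact h (Complex.ext p1 p2)
    · exact h (Complex.ext q1 q2)
  have hc1 : 0 < 1 - c := by nlinarith [sq_pos_of_pos hS]
  have hD0 : D < 0 := by
    have : D = (1 - c) * (2 * r ^ 2 - (1 + c)) := by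
      rw [hD]; linear_combination (r ^ 2 - 1) * hcS
    rw [this]
    exact mul_neg_of_pos_of_neg hc1 (by linarith)
  clear_value A B D
  obtain ⟨s, ⟨hs, hroot⟩, huniq⟩ := existsUnique_pos_root A B D hA0 hD0
  have hS0 : S ≠ 0 := hS.ne'
  set u : ℂ := ⟨r + s * p.re, (r + s * q.re - (r + s * p.re) * c) / S⟩ with hu
  set o : ℂ := ⟨s * q.im, s * p.im⟩ with ho
  set y : C2 := !₂[u / e, o / Complex.I ^ k] with hy
  have y0 : y 0 * e = u := by simp [hy, he0]
  have y1 : y 1 * Complex.I ^ k = o := by simp [hy, hI0]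
  clear_value y
  have hy1 : ‖y‖ ^ 2 = 1 := by
    rw [hnorm, y0, y1, hu, ho]
    simp only
    generalize hg : (r + s * q.re - (r + s * p.re) * c) / S = g
    have hg' : g * S = r + s * q.re - (r + s * p.re) * c := by rw [← hg]; field_simp
    have h6 : (g * S) ^ 2 = (r + s * q.re - (r + s * p.re) * c) ^ 2 := by rw [hg']
    rw [hA, hB, hD] at hroot
    refine mul_left_cancel₀ (pow_ne_zero 2 hS0) ?_
    linear_combination hroot + h6
  have hyS : y ∈ Metric.sphere (0 : C2) 1 := by
    rw [mem_sphere_zero_iff_norm]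
    exact (pow_eq_one_iff_of_nonneg (norm_nonneg y) two_ne_zero).1 hy1
  refine ⟨⟨y, hyS⟩, ⟨s, hs, (key _ _).2 ?_⟩, ?_⟩
  · simp only [y0, y1, hu, ho]
    refine ⟨trivial, ?_, trivial, trivial⟩
    field_simp
  · rintro x ⟨t, ht, hx⟩
    obtain ⟨h1, h2, h3, h4⟩ := (key _ _).1 hx
    have hx1 : ‖(x : C2)‖ ^ 2 = 1 := by
      rw [mem_sphere_zero_iff_norm.1 x.2]; norm_num
    rw [hnorm, h1, h3, h4] at hx1
    have hts : t = s := by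
      apply huniq
      refine ⟨ht, ?_⟩
      have h5 := congrArg (fun z => z ^ 2) h2
      simp only at h5
      rw [hA, hB, hD]
      linear_combination S ^ 2 * hx1 - h5
    have hx0 : (x : C2) 0 * e = y 0 * e := by
      rw [y0, hu]
      apply Complex.ext
      · rw [h1, hts]
      · simp only
        rw [eq_div_iff hS0, h2, hts]
    have hx2 : (x : C2) 1 * Complex.I ^ k = y 1 * Complex.I ^ k := by
      rw [y1, ho]
      apply Complex.ext
      · rw [h4, hts]
      · rw [h3, hts]
    apply Subtype.ext
    ext j
    fin_cases j
    · exact mul_right_cancel₀ he0 hx0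
    · exact mul_right_cancel₀ hI0 hx2

open Classical in
/-- The point of `S³` at which `(chainFun n k, chainFun n (k + 1))` is a positive multiple of
`(p, q)`. (The value `x` is used only if there is no such point.) In other words, the pair of
functions, followed by radial projection, is an orientation-preserving homeomorphism of `S³` that
takes the `k`-th and the `(k+1)`-st component to the standard Hopf link in the unit sphere of `ℂ²`,
and this is the point with image `(p, q) / |(p, q)|`. -/
def hopfPoint (n k : ℕ) (x : S3) (p q : ℂ) : S3 :=
  if h : ∃ y : S3, ∃ s : ℝ, 0 < s ∧ chainFun n k y = s * p ∧ chainFun n (k + 1) y = s * q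
  then h.choose else x

/-! ### Dehn twists along annuli, and `ml`-swaps -/

/-- The rotation `e^{i (2 θ + π)}` at a point with argument `θ ∈ [-π/2, π/2]`, and `1` at the points
with nonpositive real part: a full turn, from angle `0` to angle `2π`, as the argument runs from
`-π/2` to `π/2`. -/
def fullTurn (p : ℂ) : ℂ := if 0 < p.re then -(p / ‖p‖) ^ 2 else 1

/-- The right-handed Dehn twist along the annulus `A k = D k \ K (k + 1)`. With
`p = chainFun n k` and `q = chainFun n (k + 1)` the annulus is `{p > 0, q ≠ 0}`, its product
neighbourhood is `{Re p > 0, q ≠ 0}` with the interval coordinate `arg p`, and the rotation of the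
annulus is the rotation of `q`. The twist is a homeomorphism of the complement of the two circles
`p = 0` and `q = 0`, the identity outside the product neighbourhood; on the two circles it is put
equal to the identity. -/
def rightTwist (n k : ℕ) (x : S3) : S3 :=
  hopfPoint n k x (chainFun n k x) (fullTurn (chainFun n k x) * chainFun n (k + 1) x)

/-- The left-handed Dehn twist along the annulus `A (k + 1) = D (k + 1) \ K k`, in the same
coordinates: the roles of `p` and `q` are exchanged and the rotation is inverted. -/
def leftTwist (n k : ℕ) (x : S3) : S3 :=
  hopfPoint n k x (star (fullTurn (chainFun n (k + 1) x)) * chainFun n k x) (chainFun n (k + 1) x)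

/-- The `i`-th `ml`-swap: a right-handed twist along `A i`, then a left-handed twist along
`A (i + 1)`, then a right-handed twist along `A i`. On `K i` and `K (i + 1)` it is the identity. -/
def mlSwap (n : ℕ) (i : ZMod (2 * n)) (x : S3) : S3 :=
  rightTwist n i.val (leftTwist n i.val (rightTwist n i.val x))

/-- The `ml`-swaps with indices `i` and `j` do not overlap: `|i - j| ≥ 4` modulo `2n`. -/
def NonOverlapping (n : ℕ) (i j : ZMod (2 * n)) : Prop := 4 ≤ (i - j).valMinAbs.natAbs

/-- The composition of the `ml`-swaps in a list of indices. -/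
def mlSwaps (n : ℕ) (l : List (ZMod (2 * n))) : S3 → S3 :=
  l.foldr (fun i f => mlSwap n i ∘ f) id

/-- `L` is a non-overlapping nested partner of the chain link, created by the `ml`-swaps with
indices in the list `l`: these do not overlap, and `L` is isotopic to the link that they produce. -/
def IsNestedPartner (n : ℕ) (l : List (ZMod (2 * n))) (L : ZMod (2 * n) → Set S3) : Prop :=
  l.Pairwise (NonOverlapping n) ∧ LinkIsotopic (fun j => mlSwaps n l '' chainLink n j) L

/-- The sublink involved in a list of `ml`-swaps: the union of the Hopf links `K i ∪ K (i + 1)`. -/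
def hopfSublink (n : ℕ) (l : List (ZMod (2 * n))) : Set (ZMod (2 * n)) :=
  {j | ∃ i ∈ l, j = i ∨ j = i + 1}

end

/-!
Let `a` and `b` be the functions that vanish on `K i` and `K (i + 1)`. Followed by radial
projection, `(a, b)` identifies `S³` with the unit sphere of `ℂ²`, and the complement of the Hopf
link `K i ∪ K (i + 1)` is foliated by tori with coordinates `(dir a, dir b)`. The twists, and hence
the `ml`-swap, act on every torus by one and the same bijection. Unwinding the twisting functions
deforms it through bijections to the linear map `(x, y) ↦ (y⁻¹, x)`, which exchanges the factors.

To extend the swap over the solid torus glued in at `K i`, blow up the core of the given tube: since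
the tube is an immersion, `a` divided by the radius has no zeros up to radius `0`, so the angles
extend to the blow-up. At radius `0` the first angle is the direction of the derivative of `a` along
the meridian disk, a fibrewise linear isomorphism of `ℂ` over the longitude circle. It has no
winding because the longitude is preferred, and is therefore isotopic to a constant linear map. So
the swap at radius `0` is isotopic to a map that exchanges the factors of the torus up to
reparametrizing them. Reparametrizing the tori of the solid torus by this isotopy makes the swap
independent of the new meridian angle at radius `0`, so that it descends from polar coordinates to
the solid torus.

The swap `s i` is the identity where `a` and `b` have nonpositive real part, that is, off two
spherical caps. For non-overlapping swaps these caps are disjoint, so that the swaps commute and fix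
the components used by the others, and the fillings compose.
-/

noncomputable section

/-! ### Immersed hypersurfaces of the sphere -/

section Immersion

variable {E F : Type*} [NormedAddCommGroup E] [InnerProductSpace ℝ E] [NormedAddCommGroup F]
  [NormedSpace ℝ F]

theorem inner_eq_zero_of_hasFDerivAt_of_norm_eq_one {φ : F → E} {φ' : F →L[ℝ] E} {y : F}
    (hφ : HasFDerivAt φ φ' y) (hnorm : ∀ y, ‖φ y‖ = 1) (ξ : F) : inner ℝ (φ y) (φ' ξ) = 0 := by
  have hsq := hφ.norm_sq
  simp only [hnorm, one_pow] at hsq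
  simpa using congrArg (· ξ) (hsq.unique (hasFDerivAt_const _ _))

theorem injective_smul_add_smul_of_inner_eq_zero {φ' : F →L[ℝ] E} {x : E}
    (hφ' : Function.Injective φ') (hx : ‖x‖ = 1) (horth : ∀ ξ, inner ℝ x (φ' ξ) = 0) :
    Function.Injective ((φ'.comp (.fst ℝ F ℝ)) + (ContinuousLinearMap.snd ℝ F ℝ).smulRight x) := by
  rw [injective_iff_map_eq_zero]
  rintro ⟨ξ, c⟩ h
  replace h : φ' ξ + c • x = 0 := h
  have hc : c = 0 := by
    have := congrArg (inner ℝ x) h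
    simpa [inner_add_right, horth, inner_smul_right, real_inner_self_eq_norm_sq, hx] using this
  rw [hc, zero_smul, add_zero] at h
  rw [hc, hφ' (h.trans (map_zero φ').symm), Prod.mk_zero_zero]

variable [FiniteDimensional ℝ F] {φ : F → Metric.sphere (0 : E) 1}

theorem map_nhds_cone_of_injective_fderiv
    (hdim : Module.finrank ℝ E = Module.finrank ℝ F + 1)
    (hφ : ContDiff ℝ 1 fun y => (φ y : E)) {y : F}
    (hinj : Function.Injective (fderiv ℝ (fun y => (φ y : E)) y)) :
    Filter.map (fun p : F × ℝ => p.2 • (φ p.1 : E)) (nhds (y, 1)) = nhds (φ y : E) := by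
  have : FiniteDimensional ℝ E := .of_finrank_pos (by omega)
  have : CompleteSpace E := FiniteDimensional.complete ℝ E
  have : CompleteSpace F := FiniteDimensional.complete ℝ F
  have hnorm : ∀ y, ‖(φ y : E)‖ = 1 := fun y => mem_sphere_zero_iff_norm.1 (φ y).2
  have hcone : ContDiff ℝ 1 fun p : F × ℝ => p.2 • (φ p.1 : E) :=
    contDiff_snd.smul (hφ.comp contDiff_fst)
  have hφy := (hφ.differentiable one_ne_zero y).hasFDerivAt
  have hderiv : HasFDerivAt (fun p : F × ℝ => p.2 • (φ p.1 : E)) _ (y, (1 : ℝ)) :=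
    hasFDerivAt_snd.smul (HasFDerivAt.comp (f := Prod.fst) (g := fun y => (φ y : E))
      (y, (1 : ℝ)) hφy hasFDerivAt_fst)
  have hstrict := hcone.contDiffAt.hasStrictFDerivAt' hderiv one_ne_zero
  refine (hstrict.map_nhds_eq_of_surj (LinearMap.range_eq_top.2 ?_)).trans (by simp)
  refine (LinearMap.injective_iff_surjective_of_finrank_eq_finrank ?_).1 ?_
  · rw [Module.finrank_prod, Module.finrank_self, hdim]
  · have hlin := injective_smul_add_smul_of_inner_eq_zero hinj (hnorm y)
      (inner_eq_zero_of_hasFDerivAt_of_norm_eq_one hφy hnorm)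
    convert hlin using 1
    ext p
    simp

theorem isOpenMap_of_injective_fderiv (hdim : Module.finrank ℝ E = Module.finrank ℝ F + 1)
    (hφ : ContDiff ℝ 1 fun y => (φ y : E))
    (hinj : ∀ y, Function.Injective (fderiv ℝ (fun y => (φ y : E)) y)) : IsOpenMap φ := by
  refine IsOpenMap.of_nhds_le fun y s hs => ?_
  have hmem : {p : F × ℝ | φ p.1 ∈ s ∧ 0 < p.2} ∈ nhds (y, (1 : ℝ)) :=
    Filter.inter_mem (continuous_fst.tendsto (y, (1 : ℝ)) hs)
      (continuous_snd.tendsto (y, (1 : ℝ)) (lt_mem_nhds one_pos))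
  have himage := Filter.image_mem_map (m := fun p : F × ℝ => p.2 • (φ p.1 : E)) hmem
  rw [map_nhds_cone_of_injective_fderiv hdim hφ (hinj y)] at himage
  filter_upwards [continuous_subtype_val.continuousAt.preimage_mem_nhds himage]
  rintro x ⟨⟨y', c⟩, ⟨hy', hc⟩, hx⟩
  have hc1 : c = 1 := by
    have := congrArg norm hx
    simpa [norm_smul, abs_of_pos hc] using this
  simp only [hc1, one_smul] at hx
  rwa [← Subtype.ext hx]

end Immersion

/-! ### Tubes and surgery -/

theorem isOpenQuotientMap_circleExp : IsOpenQuotientMap Circle.exp :=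
  ⟨Circle.exp_surjective, Circle.exp.continuous, isLocalHomeomorph_circleExp.isOpenMap⟩

theorem isOpenQuotientMap_prodMap_circleExp (X : Type*) [TopologicalSpace X] :
    IsOpenQuotientMap (Prod.map id Circle.exp : X × ℝ → X × Circle) :=
  IsOpenQuotientMap.id.prodMap isOpenQuotientMap_circleExp

theorem finrank_C2 : Module.finrank ℝ C2 = Module.finrank ℝ (ℂ × ℝ) + 1 := by
  rw [← Module.finrank_mul_finrank ℝ ℂ C2]
  simp

namespace TubeSystem

section Topology

variable {ι : Type} {K : ι → Set S3} (T : TubeSystem K)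

theorem continuous_tube (j : ι) : Continuous (T.tube j) := by
  rw [(isOpenQuotientMap_prodMap_circleExp ℂ).isQuotientMap.continuous_iff,
    continuous_induced_rng]
  exact (T.smooth j).continuous

theorem isOpenMap_tube (j : ι) : IsOpenMap (T.tube j) := by
  have hlift : IsOpenMap fun y : ℂ × ℝ => T.tube j (y.1, Circle.exp y.2) :=
    isOpenMap_of_injective_fderiv finrank_C2 ((T.smooth j).of_le (by norm_cast)) (T.immersion j)
  exact IsOpenMap.of_comp (isOpenQuotientMap_prodMap_circleExp ℂ).continuous
    (isOpenQuotientMap_prodMap_circleExp ℂ).surjective hlift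

theorem isClosed_exterior : IsClosed T.exterior := by
  have : T.exterior = ⋂ j, (T.tube j '' (Metric.ball 0 1 ×ˢ Set.univ))ᶜ := by
    ext x
    simp only [exterior, Set.mem_ofPred_eq, Set.mem_iInter, Set.mem_compl_iff]
  rw [this]
  exact isClosed_iInter fun j =>
    (T.isOpenMap_tube j _ (Metric.isOpen_ball.prod isOpen_univ)).isClosed_compl

instance : CompactSpace T.exterior :=
  isCompact_iff_compactSpace.1 T.isClosed_exterior.isCompact

instance [Finite ι] (S : Set ι) : CompactSpace (T.Surgery S) :=
  inferInstanceAs (CompactSpace (Quot (T.Glue S)))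

/-- The `j`-th closed tube, the image of `D² × S¹`. -/
def closedTube (j : ι) : Set S3 := T.tube j '' (Metric.closedBall 0 1 ×ˢ Set.univ)

/-- The boundary torus of the `j`-th closed tube, with its meridian and longitude coordinates. -/
def torus (j : ι) (p : Circle × Circle) : S3 := T.tube j (p.1, p.2)

theorem tube_mem_closedTube (j : ι) (y : Disk × Circle) : T.tube j (y.1, y.2) ∈ T.closedTube j :=
  ⟨(y.1, y.2), ⟨y.1.2, trivial⟩, rfl⟩

theorem range_tube_disk (j : ι) :
    Set.range (fun y : Disk × Circle => T.tube j (y.1, y.2)) = T.closedTube j := by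
  refine (Set.range_subset_iff.2 (T.tube_mem_closedTube j)).antisymm ?_
  rintro _ ⟨⟨u, v⟩, ⟨hu, -⟩, rfl⟩
  exact ⟨(⟨u, hu⟩, v), rfl⟩

theorem openTube_subset_closedTube (j : ι) :
    T.tube j '' (Metric.ball 0 1 ×ˢ Set.univ) ⊆ T.closedTube j :=
  Set.image_mono (Set.prod_mono Metric.ball_subset_closedBall subset_rfl)

theorem core_subset_openTube (j : ι) : K j ⊆ T.tube j '' (Metric.ball 0 1 ×ˢ Set.univ) := by
  rw [← T.core j]
  rintro _ ⟨v, rfl⟩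
  exact ⟨(0, v), by simp, rfl⟩

theorem core_subset_closedTube (j : ι) : K j ⊆ T.closedTube j :=
  (T.core_subset_openTube j).trans (T.openTube_subset_closedTube j)

theorem disjoint_core_closedTube {j k : ι} (h : j ≠ k) : Disjoint (K j) (T.closedTube k) :=
  (T.disjoint j k h).mono_left (T.core_subset_closedTube j)

theorem exterior_subset_compl_core (S : Set ι) : T.exterior ⊆ (⋃ j ∈ S, K j)ᶜ := by
  intro x hx
  simp only [Set.mem_compl_iff, Set.mem_iUnion, not_exists]
  exact fun j _ hxj => hx j (T.core_subset_openTube j hxj)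

theorem closedTube_subset_compl_core {S : Set ι} {j : ι} (hj : j ∉ S) :
    T.closedTube j ⊆ (⋃ k ∈ S, K k)ᶜ := by
  intro x hx
  simp only [Set.mem_compl_iff, Set.mem_iUnion, not_exists]
  exact fun k hk hxk => Set.disjoint_left.1
    (T.disjoint_core_closedTube fun h : k = j => hj (h ▸ hk)) hxk hx

theorem exists_torus_eq_of_mem_exterior {j : ι} {x : S3} (hx : x ∈ T.exterior)
    (hxj : x ∈ T.closedTube j) : ∃ p, T.torus j p = x := by
  obtain ⟨⟨u, v⟩, ⟨hu, -⟩, rfl⟩ := hxj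
  have hu1 : ‖u‖ = 1 := by
    refine le_antisymm (mem_closedBall_zero_iff.1 hu) (not_lt.1 fun hlt => ?_)
    exact hx j ⟨(u, v), ⟨mem_ball_zero_iff.2 hlt, trivial⟩, rfl⟩
  exact ⟨(⟨u, mem_sphere_zero_iff_norm.2 hu1⟩, v), rfl⟩

end Topology

section Filling

variable {ι : Type} {K : ι → Set S3}

/-- `G` fills in the image under `f` of the `j`-th closed tube by a solid torus. The bijection `σ`
of the torus relates the coordinates on the boundary of the solid torus to those on the boundary
of the tube. -/
structure IsFilling (T : TubeSystem K) (f : S3 → S3) (j : ι)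
    (σ : Circle × Circle → Circle × Circle) (G : Disk × Circle → S3) : Prop where
  continuous : Continuous G
  injective : Function.Injective G
  boundary : ∀ p : Circle × Circle, G (diskBoundary p.1, p.2) = f (T.torus j (σ p))
  range_eq : Set.range G = f '' T.closedTube j
  range_core : Set.range (fun v => G (diskCentre, v)) = f '' K j

variable (T : TubeSystem K)

theorem isFilling_id (j : ι) : T.IsFilling id j id fun y => T.tube j (y.1, y.2) where
  continuous := (T.continuous_tube j).comp (by fun_prop)
  injective y y' h := by
    have := T.injective j h
    simp only [Prod.mk.injEq] at this
    exact Prod.ext (Subtype.ext this.1) this.2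
  boundary _ := rfl
  range_eq := by rw [Set.image_id, T.range_tube_disk]
  range_core := by
    rw [Set.image_id, ← T.core j]
    rfl

variable {T} {f g : S3 → S3} {j : ι} {S : Set ι} {σ : Circle × Circle → Circle × Circle}
  {G : Disk × Circle → S3}

theorem IsFilling.comp (h : T.IsFilling f j σ G) (hg : Function.Injective g)
    (hcont : ContinuousOn g (f '' T.closedTube j)) : T.IsFilling (g ∘ f) j σ (g ∘ G) where
  continuous := hcont.comp_continuous h.continuous fun y => h.range_eq ▸ Set.mem_range_self y
  injective := hg.comp h.injective
  boundary p := congrArg g (h.boundary p)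
  range_eq := by rw [Set.range_comp, h.range_eq, Set.image_comp]
  range_core := by
    rw [Set.image_comp, ← h.range_core, ← Set.range_comp]
    rfl

theorem IsFilling.eq_boundary_of_eq (h : T.IsFilling f j σ G) (hf : Function.Injective f)
    (hσ : Function.Surjective σ) {x : S3} (hx : x ∈ T.exterior) {y : Disk × Circle}
    (hxy : f x = G y) : ∃ p, y = (diskBoundary p.1, p.2) ∧ x = T.torus j (σ p) := by
  have hxj : x ∈ T.closedTube j := by
    rw [← hf.mem_set_image, ← h.range_eq, hxy]
    exact Set.mem_range_self y
  obtain ⟨q, rfl⟩ := T.exists_torus_eq_of_mem_exterior hx hxj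
  obtain ⟨p, rfl⟩ := hσ q
  exact ⟨p, h.injective (hxy.symm.trans (h.boundary p).symm), rfl⟩

open Classical in
/-- The gluing of the boundary of the `j`-th solid torus in the surgery on the sublink `S`, in the
meridian and longitude coordinates. -/
def gluing (S : Set ι) (j : ι) : Circle × Circle → Circle × Circle :=
  if j ∈ S then Prod.swap else id

theorem surjective_gluing : Function.Surjective (gluing S j) := by
  unfold gluing
  split_ifs
  exacts [Prod.swap_surjective, Function.surjective_id]

theorem glue_of_eq_torus {p : Circle × Circle} {x : T.exterior}
    (hx : (x : S3) = T.torus j (gluing S j p)) :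
    T.Glue S (.inr ⟨j, diskBoundary p.1, p.2⟩) (.inl x) := by
  by_cases hj : j ∈ S
  · exact .swap j hj p.1 p.2 x (by rw [hx, gluing, if_pos hj]; rfl)
  · exact .keep j hj p.1 p.2 x (by rw [hx, gluing, if_neg hj]; rfl)

variable {G : ι → Disk × Circle → S3}

theorem Glue.elim_eq (hG : ∀ j, T.IsFilling f j (gluing S j) (G j))
    {a b : T.exterior ⊕ (Σ _ : ι, Disk × Circle)} (hab : T.Glue S a b) :
    Sum.elim (fun x : T.exterior => f x) (fun y => G y.1 y.2) a =
      Sum.elim (fun x : T.exterior => f x) (fun y => G y.1 y.2) b := by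
  rcases hab with ⟨j, hj, u, v, x, hx⟩ | ⟨j, hj, u, v, x, hx⟩
  · exact ((hG j).boundary (u, v)).trans (by simp [gluing, hj, torus, hx])
  · exact ((hG j).boundary (u, v)).trans (by simp [gluing, hj, torus, hx])

/-- The map from the surgered space to `S³` that is equal to `f` on the exterior and to the given
fillings on the solid tori. -/
def surgeryMap (hG : ∀ j, T.IsFilling f j (gluing S j) (G j)) : T.Surgery S → S3 :=
  Quot.lift (Sum.elim (fun x : T.exterior => f x) fun y => G y.1 y.2) fun _ _ => Glue.elim_eq hG

variable (hG : ∀ j, T.IsFilling f j (gluing S j) (G j))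

include hG

theorem continuous_surgeryMap (hf : ContinuousOn f T.exterior) : Continuous (surgeryMap hG) :=
  continuous_quot_lift _ (hf.domRestrict.sumElim (continuous_sigma fun j => (hG j).continuous))

theorem injective_surgeryMap (hf : Function.Injective f) :
    Function.Injective (surgeryMap hG) := by
  have hglue : ∀ (x : T.exterior) j y, f x = G j y → T.Glue S (.inr ⟨j, y⟩) (.inl x) := by
    intro x j y hxy
    obtain ⟨p, rfl, hx⟩ := (hG j).eq_boundary_of_eq hf surjective_gluing x.2 hxy
    exact glue_of_eq_torus hx
  rintro ⟨x | ⟨j, y⟩⟩ ⟨x' | ⟨j', y'⟩⟩ h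
  · rw [Subtype.ext (hf h)]
  · exact (Quot.sound (hglue x j' y' h)).symm
  · exact Quot.sound (hglue x' j y h.symm)
  · replace h : G j y = G j' y' := h
    obtain rfl | hj := eq_or_ne j j'
    · rw [(hG j).injective h]
    · have hmem : G j y ∈ f '' T.closedTube j ∩ f '' T.closedTube j' := by
        rw [← (hG j).range_eq, ← (hG j').range_eq]
        exact ⟨⟨y, rfl⟩, ⟨y', h.symm⟩⟩
      have hdisj : Disjoint (T.closedTube j) (T.closedTube j') := T.disjoint j j' hj
      rw [← Set.image_inter hf, hdisj.inter_eq, Set.image_empty] at hmem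
      exact hmem.elim

theorem surjective_surgeryMap (hf : Function.Surjective f) :
    Function.Surjective (surgeryMap hG) := by
  intro z
  obtain ⟨x, rfl⟩ := hf z
  by_cases hx : x ∈ T.exterior
  · exact ⟨T.ofExterior S ⟨x, hx⟩, rfl⟩
  · simp only [exterior, Set.mem_ofPred_eq, not_forall, not_not] at hx
    obtain ⟨j, hj⟩ := hx
    obtain ⟨y, hy⟩ : f x ∈ Set.range (G j) := by
      rw [(hG j).range_eq]
      exact ⟨x, T.openTube_subset_closedTube j hj, rfl⟩
    exact ⟨Quot.mk _ (.inr ⟨j, y⟩), hy⟩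

theorem exists_homeomorph_of_isFilling [Finite ι] (hf : Function.Bijective f)
    (hcont : ContinuousOn f T.exterior) :
    ∃ F : T.Surgery S ≃ₜ S3, (∀ x : T.exterior, F (T.ofExterior S x) = f x) ∧
      ∀ j, F '' T.coreLink S j = f '' K j := by
  have hbij : Function.Bijective (surgeryMap hG) :=
    ⟨injective_surgeryMap hG hf.1, surjective_surgeryMap hG hf.2⟩
  refine ⟨(isHomeomorph_iff_continuous_bijective.2
    ⟨continuous_surgeryMap hG hcont, hbij⟩).homeomorph _, fun x => rfl, fun j => ?_⟩
  rw [← (hG j).range_core]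
  exact (Set.range_comp _ _).symm

end Filling

section Realizes

variable {ι : Type} {K : ι → Set S3}

/-- `f` is a bijection of `S³` that is continuous off the components of the sublink `S`, preserves
these components, and extends over the solid tori that are glued in by `0`-surgery on `S`. -/
structure Realizes (T : TubeSystem K) (S : Set ι) (f : S3 → S3) : Prop where
  bijective : Function.Bijective f
  continuousOn : ContinuousOn f (⋃ j ∈ S, K j)ᶜ
  image_core : ∀ j ∈ S, f '' K j = K j
  exists_isFilling : ∀ j ∈ S, ∃ G, T.IsFilling f j Prod.swap G

variable {T : TubeSystem K} {S S' : Set ι} {f g : S3 → S3}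

theorem realizes_empty (T : TubeSystem K) : T.Realizes ∅ id :=
  ⟨Function.bijective_id, continuousOn_id, fun _ h => h.elim, fun _ h => h.elim⟩

theorem Realizes.exists_homeomorph [Finite ι] (h : T.Realizes S f) :
    ∃ F : T.Surgery S ≃ₜ S3, (∀ x : T.exterior, F (T.ofExterior S x) = f x) ∧
      ∀ j, F '' T.coreLink S j = f '' K j := by
  have hfill : ∀ j, ∃ G, T.IsFilling f j (gluing S j) G := by
    intro j
    by_cases hj : j ∈ S
    · simpa only [gluing, if_pos hj] using h.exists_isFilling j hj
    · have := (T.isFilling_id j).comp h.bijective.1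
        (by simpa using h.continuousOn.mono (T.closedTube_subset_compl_core hj))
      exact ⟨_, by simpa only [gluing, if_neg hj, Function.comp_id] using this⟩
  choose G hG using hfill
  exact exists_homeomorph_of_isFilling hG h.bijective
    (h.continuousOn.mono (T.exterior_subset_compl_core S))

theorem image_compl_core_subset (hf : Function.Injective f) (hfS : ∀ j ∈ S, f '' K j = K j) :
    f '' (⋃ j ∈ S, K j)ᶜ ⊆ (⋃ j ∈ S, K j)ᶜ := by
  have : f '' ⋃ j ∈ S, K j = ⋃ j ∈ S, K j := by
    simp only [Set.image_iUnion]
    exact Set.iUnion₂_congr hfS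
  nth_rewrite 2 [← this]
  exact Set.image_compl_subset hf

theorem Realizes.exists_isFilling_comp (hf : T.Realizes S f) (hg : T.Realizes S' g)
    (hdisj : Disjoint S S') (hfS' : ∀ j ∈ S', f '' K j = K j) {j : ι} (hj : j ∈ S) :
    ∃ G, T.IsFilling (g ∘ f) j Prod.swap G := by
  obtain ⟨G, hG⟩ := hf.exists_isFilling j hj
  refine ⟨_, hG.comp hg.bijective.1 (hg.continuousOn.mono ?_)⟩
  exact (Set.image_mono (T.closedTube_subset_compl_core (Set.disjoint_left.1 hdisj hj))).trans
    (image_compl_core_subset hf.bijective.1 hfS')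

theorem Realizes.comp (hf : T.Realizes S f) (hg : T.Realizes S' g) (hdisj : Disjoint S S')
    (hcomm : f ∘ g = g ∘ f) (hfS' : ∀ j ∈ S', f '' K j = K j) (hgS : ∀ j ∈ S, g '' K j = K j) :
    T.Realizes (S ∪ S') (f ∘ g) where
  bijective := hf.bijective.comp hg.bijective
  continuousOn := by
    refine hf.continuousOn.comp (hg.continuousOn.mono ?_) (Set.mapsTo_iff_image_subset.2 ?_) <;>
      rw [Set.biUnion_union, Set.compl_union]
    · exact Set.inter_subset_right
    · exact (Set.image_mono Set.inter_subset_left).trans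
        (image_compl_core_subset hg.bijective.1 hgS)
  image_core := by
    rintro j (hj | hj)
    · rw [Set.image_comp, hgS j hj, hf.image_core j hj]
    · rw [Set.image_comp, hg.image_core j hj, hfS' j hj]
  exists_isFilling := by
    rintro j (hj | hj)
    · rw [hcomm]
      exact hf.exists_isFilling_comp hg hdisj hfS' hj
    · exact hg.exists_isFilling_comp hf hdisj.symm hgS hj

end Realizes

end TubeSystem

/-! ### Continuous arguments of circle-valued functions -/

theorem exists_arg_of_closed_lift {f : Circle → Circle} {L : unitInterval → ℝ} (hL : Continuous L)
    (h : ∀ t : unitInterval, Circle.exp (L t) = f (Circle.exp (2 * Real.pi * t)))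
    (h01 : L 0 = L 1) : ∃ σ : C(Circle, ℝ), ∀ v, Circle.exp (σ v) = f v := by
  set L' : ℝ → ℝ := Set.IccExtend zero_le_one L
  have hval : ∀ t : unitInterval, L' t = L t := Set.IccExtend_val zero_le_one L
  have hcont : Continuous (AddCircle.liftIco 1 0 L') :=
    AddCircle.liftIco_zero_continuous (by simpa using (hval 0).trans (h01.trans (hval 1).symm))
      hL.Icc_extend'.continuousOn
  let e : AddCircle (1 : ℝ) ≃ₜ Circle := AddCircle.homeomorphCircle one_ne_zero
  refine ⟨⟨fun v => AddCircle.liftIco 1 0 L' (e.symm v), hcont.comp e.symm.continuous⟩,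
    fun v => ?_⟩
  obtain ⟨z, rfl⟩ := e.surjective v
  obtain ⟨t, ht, rfl⟩ : ∃ t ∈ Set.Ico (0 : ℝ) 1, (t : AddCircle (1 : ℝ)) = z := by
    have := (AddCircle.coe_image_Ico_eq (1 : ℝ) 0).ge (Set.mem_univ z)
    rwa [zero_add] at this
  have he : e (t : AddCircle (1 : ℝ)) = Circle.exp (2 * Real.pi * t) := by
    rw [AddCircle.homeomorphCircle_apply, AddCircle.toCircle_apply_mk, div_one]
  simp only [ContinuousMap.coe_mk, Homeomorph.symm_apply_apply,
    AddCircle.liftIco_zero_coe_apply ht]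
  rw [he, ← h ⟨t, Set.Ico_subset_Icc_self ht⟩, ← hval]

theorem NullHomologousIn.exists_arg {U : Set S3} {γ : Circle → S3} (h : NullHomologousIn U γ)
    (f : C(U, Circle)) (hγ : ∀ v, γ v ∈ U) :
    ∃ σ : C(Circle, ℝ), ∀ v, Circle.exp (σ v) = f ⟨γ v, hγ v⟩ := by
  obtain ⟨x, p, hp, hab⟩ := h
  obtain ⟨e, he⟩ := Circle.exp_surjective (f x)
  have hcov := Circle.isAddQuotientCoveringMap_exp
  let windingNumber : FundamentalGroup U x →* (Multiplicative (AddSubgroup.zmultiples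
      (2 * Real.pi)))ᵐᵒᵖ :=
    (hcov.fundamentalGroupToMulOpposite ⟨e, he⟩).comp (FundamentalGroup.map f x)
  have hwinding : windingNumber (FundamentalGroup.fromPath (Path.Homotopic.Quotient.mk p)) = 1 := by
    have := congrArg (Abelianization.lift windingNumber) hab
    rwa [Abelianization.lift_apply_of, map_one] at this
  have hmonodromy := hcov.fundamentalGroupToMulOpposite_eq_one_iff.1 hwinding
  have hfx : (p.map f.continuous).toContinuousMap 0 = Circle.exp e := by simp [he]
  let L := hcov.isCoveringMap.liftPath (p.map f.continuous) e hfx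
  have hL0 : L 0 = e := hcov.isCoveringMap.liftPath_zero ..
  have hL1 : L 1 = e := congrArg Subtype.val hmonodromy
  refine exists_arg_of_closed_lift (L := L) (f := fun v => f ⟨γ v, hγ v⟩) L.continuous
    (fun t => ?_) (hL0.trans hL1.symm)
  exact (congrFun (hcov.isCoveringMap.liftPath_lifts (p.map f.continuous) e hfx) t).trans
    (congrArg f (Subtype.ext (hp t)))

theorem exists_arg_of_homotopy (H : C(unitInterval × Circle, Circle)) (σ : C(Circle, ℝ))
    (h : ∀ v, Circle.exp (σ v) = H (0, v)) :
    ∃ σ' : C(Circle, ℝ), ∀ v, Circle.exp (σ' v) = H (1, v) := by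
  have hcov := Circle.isCoveringMap_exp
  let L := hcov.liftHomotopy H σ fun v => (h v).symm
  exact ⟨L.comp ((ContinuousMap.const _ 1).prodMk (ContinuousMap.id _)), fun v =>
    congrFun (hcov.liftHomotopy_lifts H σ fun v => (h v).symm) (1, v)⟩

/-- The direction of a complex number, with value `1` at `0`. -/
def dir (z : ℂ) : Circle := Circle.exp z.arg

theorem norm_smul_dir (z : ℂ) : ‖z‖ • (dir z : ℂ) = z := by
  rw [dir, Circle.coe_exp, Complex.real_smul, Complex.norm_mul_exp_arg_mul_I]

theorem coe_dir {z : ℂ} (hz : z ≠ 0) : (dir z : ℂ) = z / ‖z‖ := by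
  rw [eq_div_iff (by simpa using hz), mul_comm, ← Complex.real_smul, norm_smul_dir]

theorem dir_smul {s : ℝ} (hs : 0 < s) (z : ℂ) : dir (s • z) = dir z := by
  rw [dir, Complex.real_smul, Complex.arg_real_mul z hs, dir]

theorem dir_smul_circle {s : ℝ} (hs : 0 < s) (v : Circle) : dir (s • (v : ℂ)) = v := by
  rw [dir_smul hs, dir, Circle.exp_arg]

theorem continuous_dir_comp {X : Type*} [TopologicalSpace X] {f : X → ℂ} (hf : Continuous f)
    (h : ∀ x, f x ≠ 0) : Continuous fun x => dir (f x) := by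
  refine continuous_induced_rng.2 ?_
  refine (hf.div (Complex.continuous_ofReal.comp hf.norm) fun x => ?_).congr fun x =>
    (coe_dir (h x)).symm
  simpa using h x

/-! ### Coordinates adapted to a Hopf link -/

/-- A map from `X` to a normed space `E` that, followed by radial projection, is a homeomorphism
to the unit sphere; `inv` is its inverse, extended to be constant on open rays. -/
structure RadialChart (X E : Type*) [TopologicalSpace X] [NormedAddCommGroup E]
    [NormedSpace ℝ E] where
  toFun : X → E
  inv : E → X
  continuous : Continuous toFun
  ne_zero : ∀ x, toFun x ≠ 0
  exists_smul : ∀ z ≠ 0, ∃ s : ℝ, 0 < s ∧ toFun (inv z) = s • z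
  inv_eq : ∀ (x : X) (s : ℝ) (z : E), 0 < s → toFun x = s • z → inv z = x

namespace RadialChart

variable {X E : Type*} [TopologicalSpace X] [NormedAddCommGroup E] [NormedSpace ℝ E]
  (H : RadialChart X E)

theorem inv_apply (x : X) : H.inv (H.toFun x) = x :=
  H.inv_eq x 1 _ one_pos (one_smul ℝ _).symm

theorem inv_smul {s : ℝ} (hs : 0 < s) {z : E} (hz : z ≠ 0) : H.inv (s • z) = H.inv z := by
  obtain ⟨t, ht, h⟩ := H.exists_smul z hz
  exact H.inv_eq _ (t / s) _ (div_pos ht hs) (by rw [h, smul_smul, div_mul_cancel₀ t hs.ne'])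

/-- The direction of the value of the chart, a point of the unit sphere. -/
def toSphere (x : X) : Metric.sphere (0 : E) 1 :=
  (homeomorphUnitSphereProd E ⟨H.toFun x, H.ne_zero x⟩).1

theorem continuous_toSphere : Continuous H.toSphere :=
  continuous_fst.comp ((homeomorphUnitSphereProd E).continuous.comp (H.continuous.subtype_mk _))

theorem inv_unitSphereProd (z : ({0}ᶜ : Set E)) :
    H.inv (homeomorphUnitSphereProd E z).1 = H.inv z := by
  rw [homeomorphUnitSphereProd_apply_fst_coe]
  exact H.inv_smul (inv_pos.2 (norm_pos_iff.2 z.2)) z.2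

theorem toSphere_inv (z : Metric.sphere (0 : E) 1) : H.toSphere (H.inv z) = z := by
  have hz : (z : E) ≠ 0 := ne_zero_of_mem_unit_sphere z
  obtain ⟨s, hs, h⟩ := H.exists_smul z hz
  refine Subtype.ext ?_
  rw [toSphere, homeomorphUnitSphereProd_apply_fst_coe]
  simp [h, norm_smul, smul_smul, abs_of_pos hs, hs.ne']

/-- A compact space with a radial chart is homeomorphic to the unit sphere. -/
def homeomorphSphere [CompactSpace X] : X ≃ₜ Metric.sphere (0 : E) 1 :=
  Continuous.homeoOfEquivCompactToT2 (f := ⟨H.toSphere, fun z => H.inv z,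
    fun x => (H.inv_unitSphereProd _).trans (H.inv_apply x), H.toSphere_inv⟩) H.continuous_toSphere

theorem continuousOn_inv [CompactSpace X] : ContinuousOn H.inv {0}ᶜ := by
  rw [continuousOn_iff_continuous_domRestrict]
  exact (H.homeomorphSphere.symm.continuous.comp
    (continuous_fst.comp (homeomorphUnitSphereProd E).continuous)).congr H.inv_unitSphereProd

end RadialChart

/-- A pair of complex functions on `S³` that, followed by radial projection, is a homeomorphism to
the unit sphere of `ℂ × ℂ`. The zero sets of the two functions form a Hopf link. -/
abbrev HopfFrame : Type := RadialChart S3 (ℂ × ℂ)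

namespace HopfFrame

variable (H : HopfFrame)

/-- The function that vanishes on the first component of the Hopf link. -/
def a (x : S3) : ℂ := (H.toFun x).1

/-- The function that vanishes on the second component of the Hopf link. -/
def b (x : S3) : ℂ := (H.toFun x).2

/-- The coordinates on the tori around the Hopf link. -/
def angles (x : S3) : Circle × Circle := (dir (H.a x), dir (H.b x))

/-- The frame with the two functions exchanged. -/
def swap : HopfFrame where
  toFun := Prod.swap ∘ H.toFun
  inv := H.inv ∘ Prod.swap
  continuous := continuous_swap.comp H.continuous
  ne_zero x h := H.ne_zero x (Prod.swap_injective h)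
  exists_smul z hz := by
    obtain ⟨s, hs, h⟩ := H.exists_smul z.swap fun h => hz (Prod.swap_injective h)
    exact ⟨s, hs, congrArg Prod.swap h⟩
  inv_eq x s z hs h := H.inv_eq x s z.swap hs (congrArg Prod.swap h)

theorem continuous_a : Continuous H.a := continuous_fst.comp H.continuous

theorem continuous_b : Continuous H.b := continuous_snd.comp H.continuous

variable {H}

theorem b_ne_zero_of_a_eq_zero {x : S3} (h : H.a x = 0) : H.b x ≠ 0 :=
  fun h' => H.ne_zero x (Prod.ext h h')

theorem inv_eq_of_eq_smul {x : S3} {s : ℝ} (hs : 0 < s) {p q : ℂ} (ha : H.a x = s • p)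
    (hb : H.b x = s • q) : H.inv (p, q) = x :=
  H.inv_eq x s (p, q) hs (Prod.ext ha hb)

theorem exists_inv_eq_smul {p q : ℂ} (h : (p, q) ≠ 0) :
    ∃ s : ℝ, 0 < s ∧ H.a (H.inv (p, q)) = s • p ∧ H.b (H.inv (p, q)) = s • q := by
  obtain ⟨s, hs, hinv⟩ := H.exists_smul (p, q) h
  exact ⟨s, hs, congrArg Prod.fst hinv, congrArg Prod.snd hinv⟩

theorem mk_zero_coe_ne_zero (v : Circle) : ((0 : ℂ), (v : ℂ)) ≠ 0 :=
  fun h => v.coe_ne_zero (congrArg Prod.snd h)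

theorem injective_inv_zero_circle : Function.Injective fun v : Circle => H.inv (0, v) := by
  have hdir : ∀ v : Circle, dir (H.b (H.inv (0, v))) = v := by
    intro v
    obtain ⟨s, hs, -, hb⟩ := H.exists_inv_eq_smul (mk_zero_coe_ne_zero v)
    rw [hb, dir_smul_circle hs]
  intro v w h
  rw [← hdir v, ← hdir w]
  exact congrArg (fun x => dir (H.b x)) h

theorem range_inv_zero_circle : Set.range (fun v : Circle => H.inv (0, v)) = {x | H.a x = 0} := by
  ext x
  constructor
  · rintro ⟨v, rfl⟩
    obtain ⟨s, -, ha, -⟩ := H.exists_inv_eq_smul (mk_zero_coe_ne_zero v)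
    exact ha.trans (smul_zero s)
  · intro hx
    have hb := b_ne_zero_of_a_eq_zero hx
    exact ⟨dir (H.b x), inv_eq_of_eq_smul (norm_pos_iff.2 hb) (hx.trans (smul_zero _).symm)
      (norm_smul_dir _).symm⟩

/-! ### Maps that preserve the tori around a Hopf link -/

variable (H) in
open Classical in
/-- The map of `S³` that acts by `g` on the tori around the Hopf link and is the identity on the
link itself. -/
def torusMap (g : Circle × Circle → Circle × Circle) (x : S3) : S3 :=
  if H.a x = 0 ∨ H.b x = 0 then x
  else H.inv (‖H.a x‖ • ((g (H.angles x)).1 : ℂ), ‖H.b x‖ • ((g (H.angles x)).2 : ℂ))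

variable {g : Circle × Circle → Circle × Circle} {x : S3}

theorem torusMap_of_eq_zero (h : H.a x = 0 ∨ H.b x = 0) : H.torusMap g x = x := if_pos h

theorem torusMap_of_ne_zero (ha : H.a x ≠ 0) (hb : H.b x ≠ 0) :
    H.torusMap g x =
      H.inv (‖H.a x‖ • ((g (H.angles x)).1 : ℂ), ‖H.b x‖ • ((g (H.angles x)).2 : ℂ)) :=
  if_neg (not_or.2 ⟨ha, hb⟩)

theorem mk_norm_smul_ne_zero (ha : H.a x ≠ 0) (u : Circle) (w : ℂ) : (‖H.a x‖ • (u : ℂ), w) ≠ 0 :=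
  fun h => smul_ne_zero (norm_ne_zero_iff.2 ha) u.coe_ne_zero (congrArg Prod.fst h)

theorem exists_torusMap_eq_smul (g : Circle × Circle → Circle × Circle) (ha : H.a x ≠ 0)
    (hb : H.b x ≠ 0) :
    ∃ s : ℝ, 0 < s ∧ H.a (H.torusMap g x) = (s * ‖H.a x‖) • ((g (H.angles x)).1 : ℂ) ∧
      H.b (H.torusMap g x) = (s * ‖H.b x‖) • ((g (H.angles x)).2 : ℂ) := by
  rw [torusMap_of_ne_zero ha hb]
  obtain ⟨s, hs, h⟩ := H.exists_inv_eq_smul (mk_norm_smul_ne_zero ha (g (H.angles x)).1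
    (‖H.b x‖ • ((g (H.angles x)).2 : ℂ)))
  exact ⟨s, hs, by simpa only [smul_smul] using h⟩

theorem torusMap_comp (g g' : Circle × Circle → Circle × Circle) (x : S3) :
    H.torusMap (g ∘ g') x = H.torusMap g (H.torusMap g' x) := by
  by_cases h : H.a x = 0 ∨ H.b x = 0
  · simp only [torusMap_of_eq_zero h]
  · obtain ⟨ha, hb⟩ := not_or.1 h
    obtain ⟨s, hs, ha', hb'⟩ := exists_torusMap_eq_smul g' ha hb
    have hsa : 0 < s * ‖H.a x‖ := mul_pos hs (norm_pos_iff.2 ha)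
    have hsb : 0 < s * ‖H.b x‖ := mul_pos hs (norm_pos_iff.2 hb)
    have hangles : H.angles (H.torusMap g' x) = g' (H.angles x) := by
      rw [angles, ha', hb', dir_smul_circle hsa, dir_smul_circle hsb]
    rw [torusMap_of_ne_zero ha hb, torusMap_of_ne_zero, hangles, ha', hb']
    · rw [norm_smul, norm_smul, Circle.norm_coe, Circle.norm_coe, mul_one, mul_one,
        Real.norm_of_nonneg hsa.le, Real.norm_of_nonneg hsb.le, mul_smul, mul_smul, ← Prod.smul_mk]
      exact (H.inv_smul hs (mk_norm_smul_ne_zero ha _ _)).symm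
    · exact ha' ▸ smul_ne_zero hsa.ne' (Circle.coe_ne_zero _)
    · exact hb' ▸ smul_ne_zero hsb.ne' (Circle.coe_ne_zero _)

theorem torusMap_id (x : S3) : H.torusMap id x = x := by
  by_cases h : H.a x = 0 ∨ H.b x = 0
  · exact torusMap_of_eq_zero h
  · rw [torusMap_of_ne_zero (not_or.1 h).1 (not_or.1 h).2]
    simp only [id, angles, norm_smul_dir]
    exact H.inv_apply x

theorem bijective_torusMap (hg : Function.Bijective g) : Function.Bijective (H.torusMap g) := by
  obtain ⟨g', hleft, hright⟩ := Function.bijective_iff_has_inverse.1 hg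
  refine Function.bijective_iff_has_inverse.2 ⟨H.torusMap g', fun x => ?_, fun x => ?_⟩
  · rw [← torusMap_comp, hleft.comp_eq_id, torusMap_id]
  · rw [← torusMap_comp, hright.comp_eq_id, torusMap_id]

theorem image_torusMap_of_eq_zero {A : Set S3} (h : ∀ x ∈ A, H.a x = 0 ∨ H.b x = 0) :
    H.torusMap g '' A = A := by
  rw [Set.image_congr fun x hx => torusMap_of_eq_zero (h x hx), Set.image_id']

theorem continuousOn_torusMap (hg : Continuous g) :
    ContinuousOn (H.torusMap g) {x | H.a x ≠ 0 ∧ H.b x ≠ 0} := by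
  rw [continuousOn_iff_continuous_domRestrict]
  have ha : Continuous fun x : {x | H.a x ≠ 0 ∧ H.b x ≠ 0} => H.a x :=
    H.continuous_a.comp continuous_subtype_val
  have hb : Continuous fun x : {x | H.a x ≠ 0 ∧ H.b x ≠ 0} => H.b x :=
    H.continuous_b.comp continuous_subtype_val
  have hangles : Continuous fun x : {x | H.a x ≠ 0 ∧ H.b x ≠ 0} => g (H.angles x) :=
    hg.comp ((continuous_dir_comp ha fun x => x.2.1).prodMk
      (continuous_dir_comp hb fun x => x.2.2))
  have hpair : Continuous fun x : {x | H.a x ≠ 0 ∧ H.b x ≠ 0} =>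
      (‖H.a x‖ • ((g (H.angles x)).1 : ℂ), ‖H.b x‖ • ((g (H.angles x)).2 : ℂ)) :=
    (ha.norm.smul (continuous_subtype_val.comp hangles.fst)).prodMk
      (hb.norm.smul (continuous_subtype_val.comp hangles.snd))
  exact (H.continuousOn_inv.comp_continuous hpair fun x => mk_norm_smul_ne_zero x.2.1 _ _).congr
    fun x => (torusMap_of_ne_zero x.2.1 x.2.2).symm

theorem torusMap_swap (g : Circle × Circle → Circle × Circle) (x : S3) :
    H.swap.torusMap (Prod.swap ∘ g ∘ Prod.swap) x = H.torusMap g x := by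
  simp only [torusMap, swap, a, b, angles, Function.comp_apply, Prod.fst_swap, Prod.snd_swap,
    Prod.swap_prod_mk]
  exact if_congr or_comm rfl rfl

end HopfFrame

/-! ### The chain -/

/-- The real-linear isometry of `ℂ²` to coordinates `(p, q)` in which the `k`-th component of the
chain is the circle of points of `S³` with `p = cos (3π / (4n))`. -/
def chainCoord (n k : ℕ) : C2 ≃ₗᵢ[ℝ] C2 :=
  LinearIsometry.toLinearIsometryEquiv
    { toFun := fun x =>
        !₂[⟨(x 0 * Complex.exp (-(k * Real.pi / n * Complex.I))).re, (x 1 * Complex.I ^ k).im⟩,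
          ⟨(x 0 * Complex.exp (-(k * Real.pi / n * Complex.I))).im, (x 1 * Complex.I ^ k).re⟩]
      map_add' := fun x y => by
        ext j
        fin_cases j <;> simp [add_mul, Complex.ext_iff]
      map_smul' := fun s x => by
        ext j
        fin_cases j <;> simp [Complex.ext_iff, mul_assoc, mul_sub, mul_add]
      norm_map' := fun x => by
        have hexp : ‖Complex.exp (-(k * Real.pi / n * Complex.I))‖ = 1 := by
          simp [Complex.norm_exp, Complex.div_re]
        have hsq : ∀ z : ℂ, ‖z‖ ^ 2 = z.re ^ 2 + z.im ^ 2 := fun z => by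
          rw [Complex.sq_norm, Complex.normSq_apply, sq, sq]
        refine (sq_eq_sq₀ (norm_nonneg _) (norm_nonneg _)).1 ?_
        have hζ : ‖x 0‖ = ‖x 0 * Complex.exp (-(k * Real.pi / n * Complex.I))‖ := by
          rw [norm_mul, hexp, mul_one]
        have hω : ‖x 1‖ = ‖x 1 * Complex.I ^ k‖ := by simp
        rw [EuclideanSpace.norm_sq_eq, EuclideanSpace.norm_sq_eq, Fin.sum_univ_two,
          Fin.sum_univ_two, hζ, hω]
        simp only [LinearMap.coe_mk, AddHom.coe_mk, Matrix.cons_val_zero, Matrix.cons_val_one,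
          Matrix.cons_val_fin_one, hsq]
        ring }
    rfl

/-- The cosine of the angular radius of the components of the chain. -/
def chainCos (n : ℕ) : ℝ := Real.cos (3 * Real.pi / (4 * n))

theorem chainFun_eq (n k : ℕ) (x : S3) :
    chainFun n k x = chainCoord n k x 0 - chainCos n := by
  apply Complex.ext <;> simp [chainFun, chainCoord, chainCos, -Complex.ofReal_cos]

theorem chainFun_succ_eq (n k : ℕ) (x : S3) :
    chainFun n (k + 1) x = ⟨Real.cos (Real.pi / n) * (chainCoord n k x 0).re +
      Real.sin (Real.pi / n) * (chainCoord n k x 1).re - chainCos n, (chainCoord n k x 1).im⟩ := by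
  have hexp : Complex.exp (-(((k + 1 : ℕ) : ℂ) * Real.pi / n * Complex.I)) =
      Complex.exp (-(k * Real.pi / n * Complex.I)) *
        (Real.cos (Real.pi / n) - Real.sin (Real.pi / n) * Complex.I) := by
    have : -(((k + 1 : ℕ) : ℂ) * Real.pi / n * Complex.I) =
        -(k * Real.pi / n * Complex.I) + ((-(Real.pi / n) : ℝ) : ℂ) * Complex.I := by
      push_cast
      ring
    rw [this, Complex.exp_add, Complex.exp_mul_I, ← Complex.ofReal_cos, ← Complex.ofReal_sin,
      Real.cos_neg, Real.sin_neg, Complex.ofReal_neg, neg_mul, ← sub_eq_add_neg]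
  rw [chainFun, hexp, ← mul_assoc, pow_succ, ← mul_assoc]
  apply Complex.ext
  · simp only [chainCoord, chainCos, Complex.mul_re, Complex.sub_re, Complex.sub_im,
      Complex.ofReal_re, Complex.ofReal_im, Complex.mul_im, Complex.I_re, Complex.I_im,
      LinearIsometry.coe_toLinearIsometryEquiv, LinearIsometry.coe_mk, LinearMap.coe_mk,
      AddHom.coe_mk, Matrix.cons_val_zero, Matrix.cons_val_one, Matrix.cons_val_fin_one]
    ring
  · simp [chainCoord, Complex.mul_im]

theorem norm_sq_chainCoord (n k : ℕ) (x : S3) :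
    ‖chainCoord n k x 0‖ ^ 2 + ‖chainCoord n k x 1‖ ^ 2 = 1 := by
  have hx : ‖chainCoord n k x‖ ^ 2 = 1 := by
    rw [LinearIsometryEquiv.norm_map, mem_sphere_zero_iff_norm.1 x.2, one_pow]
  rwa [EuclideanSpace.norm_sq_eq, Fin.sum_univ_two] at hx

theorem continuous_chainFun (n k : ℕ) : Continuous (chainFun n k) := by
  have hcoord : Continuous fun x : S3 => chainCoord n k x 0 :=
    (EuclideanSpace.proj (0 : Fin 2)).continuous.comp
      ((chainCoord n k).continuous.comp continuous_subtype_val)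
  exact (hcoord.sub continuous_const).congr fun x => (chainFun_eq n k x).symm

theorem chainFun_ne_zero {n : ℕ} (hn : 2 ≤ n) (k : ℕ) (x : S3) :
    chainFun n k x ≠ 0 ∨ chainFun n (k + 1) x ≠ 0 := by
  by_contra! h
  obtain ⟨hsin, hangle⟩ := chainFun_angles n hn
  have hp : chainCoord n k x 0 = chainCos n := by rw [← sub_eq_zero, ← chainFun_eq, h.1]
  have hnorm := norm_sq_chainCoord n k x
  have hsucc := (chainFun_succ_eq n k x).symm.trans h.2
  rw [hp, Complex.norm_real, Real.norm_eq_abs, sq_abs, Complex.sq_norm, Complex.normSq_apply]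
    at hnorm
  rw [hp, Complex.ext_iff] at hsucc
  obtain ⟨hre, him⟩ := hsucc
  simp only [Complex.ofReal_re, Complex.zero_re, Complex.zero_im] at hre him
  have hcs := Real.sin_sq_add_cos_sq (Real.pi / n)
  rw [him] at hnorm
  rw [← chainCos] at hangle
  generalize Real.sin (Real.pi / n) = S at *
  generalize Real.cos (Real.pi / n) = c at *
  generalize (chainCoord n k x 1).re = q at *
  generalize chainCos n = r at *
  have hfactor : (1 - c) * (1 + c - 2 * r ^ 2) = 0 := by
    linear_combination (S * q - c * r + r) * hre - S ^ 2 * hnorm + (r ^ 2 - 1) * hcs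
  have hc : 0 < 1 - c := by nlinarith [sq_pos_of_pos hsin]
  exact (mul_pos hc (by linarith)).ne' hfactor

instance : Nonempty S3 := ⟨⟨!₂[1, 0], by simp [EuclideanSpace.norm_eq]⟩⟩

/-- The frame of the `k`-th and the `(k+1)`-st component. -/
def chainFrame {n : ℕ} (hn : 2 ≤ n) (k : ℕ) : HopfFrame where
  toFun x := (chainFun n k x, chainFun n (k + 1) x)
  inv z := hopfPoint n k (Classical.arbitrary S3) z.1 z.2
  continuous := (continuous_chainFun n k).prodMk (continuous_chainFun n (k + 1))
  ne_zero x h := (chainFun_ne_zero hn k x).elim (fun h' => h' (congrArg Prod.fst h))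
    fun h' => h' (congrArg Prod.snd h)
  exists_smul z hz := by
    have hex := (existsUnique_chainFun n k hn z.1 z.2 (by
      rwa [ne_eq, Prod.ext_iff, not_and_or] at hz)).exists
    obtain ⟨s, hs, hp, hq⟩ := hex.choose_spec
    simp only [hopfPoint, dif_pos hex]
    exact ⟨s, hs, Prod.ext hp hq⟩
  inv_eq x s z hs h := by
    have hx : ∃ s : ℝ, 0 < s ∧ chainFun n k x = s * z.1 ∧ chainFun n (k + 1) x = s * z.2 :=
      ⟨s, hs, congrArg Prod.fst h, congrArg Prod.snd h⟩
    have hz : z.1 ≠ 0 ∨ z.2 ≠ 0 := by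
      refine (chainFun_ne_zero hn k x).imp (fun h' hz => h' ?_) fun h' hz => h' ?_
      · exact (congrArg Prod.fst h).trans (by simp [hz])
      · exact (congrArg Prod.snd h).trans (by simp [hz])
    have hex := existsUnique_chainFun n k hn z.1 z.2 hz
    simp only [hopfPoint, dif_pos hex.exists]
    exact hex.unique hex.exists.choose_spec hx

theorem hopfPoint_eq {n : ℕ} (hn : 2 ≤ n) (k : ℕ) (x : S3) {p q : ℂ} (h : p ≠ 0 ∨ q ≠ 0) :
    hopfPoint n k x p q = (chainFrame hn k).inv (p, q) := by
  have hex := (existsUnique_chainFun n k hn p q h).exists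
  simp only [chainFrame, hopfPoint, dif_pos hex]

theorem chainFun_add_period {n : ℕ} (hn : 2 ≤ n) (k : ℕ) (x : S3) :
    (chainFun n (k + 2 * n) x).re = (chainFun n k x).re ∧
      (chainFun n (k + 2 * n) x = 0 ↔ chainFun n k x = 0) := by
  have hn' : (n : ℂ) ≠ 0 := by exact_mod_cast (by omega : n ≠ 0)
  have hexp : Complex.exp (-(((k + 2 * n : ℕ) : ℂ) * Real.pi / n * Complex.I)) =
      Complex.exp (-(k * Real.pi / n * Complex.I)) := by
    rw [Complex.exp_eq_exp_iff_exists_int]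
    refine ⟨-1, ?_⟩
    push_cast
    field_simp
    ring
  have hpow : (Complex.I ^ (k + 2 * n) : ℂ) = Complex.I ^ k * ((-1 : ℝ) ^ n : ℝ) := by
    rw [pow_add, pow_mul, Complex.I_sq, Complex.ofReal_pow, Complex.ofReal_neg, Complex.ofReal_one]
  simp only [chainFun, hexp, hpow, true_and]
  rw [Complex.ext_iff, Complex.ext_iff, ← mul_assoc, Complex.im_mul_ofReal]
  simp

theorem chainFun_mod {n : ℕ} (hn : 2 ≤ n) (k : ℕ) (x : S3) :
    (chainFun n k x).re = (chainFun n (k : ZMod (2 * n)).val x).re ∧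
      (chainFun n k x = 0 ↔ chainFun n (k : ZMod (2 * n)).val x = 0) := by
  rw [ZMod.val_natCast]
  obtain ⟨m, hm⟩ : ∃ m, k = k % (2 * n) + m * (2 * n) :=
    ⟨k / (2 * n), (Nat.mod_add_div' k (2 * n)).symm⟩
  generalize k % (2 * n) = l at hm
  subst hm
  induction m with
  | zero => simp
  | succ m ih =>
    have hperiod := chainFun_add_period hn (l + m * (2 * n)) x
    rw [show l + (m + 1) * (2 * n) = l + m * (2 * n) + 2 * n by ring]
    exact ⟨hperiod.1.trans ih.1, hperiod.2.trans ih.2⟩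

theorem chainLink_natCast {n : ℕ} (hn : 2 ≤ n) (k : ℕ) :
    chainLink n (k : ZMod (2 * n)) = {x | chainFun n k x = 0} :=
  Set.ext fun x => (chainFun_mod hn k x).2.symm

theorem chainLink_add_one {n : ℕ} (hn : 2 ≤ n) (i : ZMod (2 * n)) :
    chainLink n (i + 1) = {x | chainFun n (i.val + 1) x = 0} := by
  have : NeZero (2 * n) := ⟨by omega⟩
  rw [← chainLink_natCast hn, Nat.cast_succ, ZMod.natCast_zmod_val]

/-! ### Twists of the torus -/

/-- A deformation of the identity map of the circle (at time `0`) to the map that is constant on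
the left half circle and doubles the angle on the right half circle (at time `1`). -/
def turn (t : ℝ) (x : Circle) : Circle :=
  x * Circle.exp (t * (Real.pi + Real.arcsin (x : ℂ).im))

theorem turn_zero (x : Circle) : turn 0 x = x := by simp [turn]

theorem continuous_turn : Continuous fun y : ℝ × Circle => turn y.1 y.2 := by
  have him : Continuous fun y : ℝ × Circle => ((y.2 : Circle) : ℂ).im :=
    Complex.continuous_im.comp (continuous_subtype_val.comp continuous_snd)
  exact continuous_snd.mul (Circle.exp.continuous.comp
    (continuous_fst.mul (continuous_const.add (Real.continuous_arcsin.comp him))))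

theorem re_sq_add_im_sq (x : Circle) : (x : ℂ).re ^ 2 + (x : ℂ).im ^ 2 = 1 := by
  rw [sq, sq, ← Complex.normSq_apply, Circle.normSq_coe]

theorem coe_exp_arcsin_im (x : Circle) :
    (Circle.exp (Real.arcsin (x : ℂ).im) : ℂ) = |(x : ℂ).re| + (x : ℂ).im * Complex.I := by
  have hsq := re_sq_add_im_sq x
  have hcos : Real.cos (Real.arcsin (x : ℂ).im) = |(x : ℂ).re| := by
    rw [Real.cos_arcsin, ← Real.sqrt_sq_eq_abs, ← hsq, add_sub_cancel_right]
  have hsin : Real.sin (Real.arcsin (x : ℂ).im) = (x : ℂ).im :=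
    Real.sin_arcsin (by nlinarith) (by nlinarith)
  rw [Circle.coe_exp, Complex.exp_mul_I, ← Complex.ofReal_cos, ← Complex.ofReal_sin, hcos, hsin]

theorem coe_turn_one (x : Circle) :
    (turn 1 x : ℂ) = if 0 < (x : ℂ).re then -(x : ℂ) ^ 2 else 1 := by
  have hturn : (turn 1 x : ℂ) = -x * (|(x : ℂ).re| + (x : ℂ).im * Complex.I) := by
    rw [turn, one_mul, Circle.exp_add, Circle.coe_mul, Circle.coe_mul, coe_exp_arcsin_im,
      Circle.coe_exp, Complex.exp_pi_mul_I]
    ring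
  rw [hturn]
  split_ifs with h
  · rw [abs_of_pos h, Complex.re_add_im]
    ring
  · have hsq : ((x : ℂ).re : ℂ) ^ 2 + (x : ℂ).im ^ 2 = 1 := by exact_mod_cast re_sq_add_im_sq x
    rw [abs_of_nonpos (not_lt.1 h), Complex.ofReal_neg]
    linear_combination (-((x : ℂ).re : ℂ) + (x : ℂ).im * Complex.I) * Complex.re_add_im (x : ℂ) +
      hsq - ((x : ℂ).im : ℂ) ^ 2 * Complex.I_sq

theorem fullTurn_eq {p : ℂ} (hp : p ≠ 0) : fullTurn p = turn 1 (dir p) := by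
  have hre : 0 < (dir p : ℂ).re ↔ 0 < p.re := by
    rw [coe_dir hp, Complex.div_ofReal_re]
    exact div_pos_iff_of_pos_right (norm_pos_iff.2 hp)
  rw [coe_turn_one, fullTurn, ← coe_dir hp]
  simp only [hre]

theorem fullTurn_ne_zero (p : ℂ) : fullTurn p ≠ 0 := by
  rcases eq_or_ne p 0 with rfl | hp
  · simp [fullTurn]
  · rw [fullTurn_eq hp]
    exact Circle.coe_ne_zero _

/-- The shear of the torus that is given by a right-handed twist (at time `1`). -/
def torusRight (t : ℝ) (y : Circle × Circle) : Circle × Circle := (y.1, turn t y.1 * y.2)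

/-- The shear of the torus that is given by a left-handed twist (at time `1`). -/
def torusLeft (t : ℝ) (y : Circle × Circle) : Circle × Circle := ((turn t y.2)⁻¹ * y.1, y.2)

/-- The action of an `ml`-swap on the tori around a Hopf link (at time `1`). -/
def torusSwap (t : ℝ) : Circle × Circle → Circle × Circle :=
  torusRight t ∘ torusLeft t ∘ torusRight t

theorem bijective_torusRight (t : ℝ) : Function.Bijective (torusRight t) :=
  Function.bijective_iff_has_inverse.2
    ⟨fun y => (y.1, (turn t y.1)⁻¹ * y.2), fun y => by simp [torusRight],
      fun y => by simp [torusRight]⟩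

theorem bijective_torusLeft (t : ℝ) : Function.Bijective (torusLeft t) :=
  Function.bijective_iff_has_inverse.2
    ⟨fun y => (turn t y.2 * y.1, y.2), fun y => by simp [torusLeft],
      fun y => by simp [torusLeft]⟩

theorem bijective_torusSwap (t : ℝ) : Function.Bijective (torusSwap t) :=
  (bijective_torusRight t).comp ((bijective_torusLeft t).comp (bijective_torusRight t))

theorem torusSwap_zero (y : Circle × Circle) : torusSwap 0 y = (y.2⁻¹, y.1) := by
  simp [torusSwap, torusLeft, torusRight, turn_zero]

@[fun_prop]
theorem continuous_torusSwap : Continuous fun y : ℝ × (Circle × Circle) => torusSwap y.1 y.2 := by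
  have hright : Continuous fun y : ℝ × (Circle × Circle) => (y.1, torusRight y.1 y.2) :=
    continuous_fst.prodMk (continuous_snd.fst.prodMk
      ((continuous_turn.comp (continuous_fst.prodMk continuous_snd.fst)).mul continuous_snd.snd))
  have hleft : Continuous fun y : ℝ × (Circle × Circle) => (y.1, torusLeft y.1 y.2) :=
    continuous_fst.prodMk (((continuous_turn.comp (continuous_fst.prodMk
      continuous_snd.snd)).inv.mul continuous_snd.fst).prodMk continuous_snd.snd)
  exact continuous_snd.comp (hright.comp (hleft.comp hright))

theorem rightTwist_eq_inv {n : ℕ} (hn : 2 ≤ n) (k : ℕ) (x : S3) :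
    rightTwist n k x = (chainFrame hn k).inv
      (chainFun n k x, fullTurn (chainFun n k x) * chainFun n (k + 1) x) :=
  hopfPoint_eq hn k x ((chainFun_ne_zero hn k x).imp_right (mul_ne_zero (fullTurn_ne_zero _)))

theorem leftTwist_eq_inv {n : ℕ} (hn : 2 ≤ n) (k : ℕ) (x : S3) :
    leftTwist n k x = (chainFrame hn k).inv
      (star (fullTurn (chainFun n (k + 1) x)) * chainFun n k x, chainFun n (k + 1) x) :=
  hopfPoint_eq hn k x ((chainFun_ne_zero hn k x).imp_left
    (mul_ne_zero (star_ne_zero.2 (fullTurn_ne_zero _))))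

theorem rightTwist_eq {n : ℕ} (hn : 2 ≤ n) (k : ℕ) (x : S3) :
    rightTwist n k x = (chainFrame hn k).torusMap (torusRight 1) x := by
  rw [rightTwist_eq_inv hn]
  by_cases h : chainFun n k x = 0 ∨ chainFun n (k + 1) x = 0
  · rw [HopfFrame.torusMap_of_eq_zero (H := chainFrame hn k) h]
    have hpair : (chainFun n k x, fullTurn (chainFun n k x) * chainFun n (k + 1) x) =
        (chainFrame hn k).toFun x := by
      rcases h with h | h <;> simp [chainFrame, h, fullTurn]
    rw [hpair, RadialChart.inv_apply]
  · obtain ⟨ha, hb⟩ := not_or.1 h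
    rw [HopfFrame.torusMap_of_ne_zero (H := chainFrame hn k) ha hb, fullTurn_eq ha]
    simp only [torusRight, HopfFrame.angles, norm_smul_dir, Circle.coe_mul, ← mul_smul_comm]
    rfl

theorem leftTwist_eq {n : ℕ} (hn : 2 ≤ n) (k : ℕ) (x : S3) :
    leftTwist n k x = (chainFrame hn k).torusMap (torusLeft 1) x := by
  rw [leftTwist_eq_inv hn]
  by_cases h : chainFun n k x = 0 ∨ chainFun n (k + 1) x = 0
  · rw [HopfFrame.torusMap_of_eq_zero (H := chainFrame hn k) h]
    have hpair : (star (fullTurn (chainFun n (k + 1) x)) * chainFun n k x, chainFun n (k + 1) x) =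
        (chainFrame hn k).toFun x := by
      rcases h with h | h <;> simp [chainFrame, h, fullTurn]
    rw [hpair, RadialChart.inv_apply]
  · obtain ⟨ha, hb⟩ := not_or.1 h
    rw [HopfFrame.torusMap_of_ne_zero (H := chainFrame hn k) ha hb, fullTurn_eq hb]
    simp only [torusLeft, HopfFrame.angles, norm_smul_dir, Circle.coe_mul, ← mul_smul_comm,
      Circle.coe_inv_eq_conj]
    rfl

theorem mlSwap_eq {n : ℕ} (hn : 2 ≤ n) (i : ZMod (2 * n)) :
    mlSwap n i = (chainFrame hn i.val).torusMap (torusSwap 1) := by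
  funext x
  rw [mlSwap, rightTwist_eq hn, leftTwist_eq hn, rightTwist_eq hn, torusSwap,
    HopfFrame.torusMap_comp, HopfFrame.torusMap_comp]

theorem bijective_mlSwap {n : ℕ} (hn : 2 ≤ n) (i : ZMod (2 * n)) :
    Function.Bijective (mlSwap n i) := by
  rw [mlSwap_eq hn]
  exact HopfFrame.bijective_torusMap (bijective_torusSwap 1)

theorem mlSwap_of_re_nonpos {n : ℕ} (hn : 2 ≤ n) (i : ZMod (2 * n)) {x : S3}
    (h : (chainFun n i.val x).re ≤ 0) (h' : (chainFun n (i.val + 1) x).re ≤ 0) :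
    mlSwap n i x = x := by
  have hright : rightTwist n i.val x = x := by
    rw [rightTwist_eq_inv hn, fullTurn, if_neg h.not_gt, one_mul]
    exact (chainFrame hn i.val).inv_apply x
  have hleft : leftTwist n i.val x = x := by
    rw [leftTwist_eq_inv hn, fullTurn, if_neg h'.not_gt, star_one, one_mul]
    exact (chainFrame hn i.val).inv_apply x
  rw [mlSwap, hright, hleft, hright]

/-! ### Blowing up the core of a tube -/

section DividedDifference

variable {E F : Type*} [NormedAddCommGroup E] [NormedSpace ℝ E] [NormedAddCommGroup F]
  [NormedSpace ℝ F]

theorem hasDerivAt_comp_add_smul {f : E → F} (hf : Differentiable ℝ f) (x v : E) (s : ℝ) :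
    HasDerivAt (fun s : ℝ => f (x + s • v)) (fderiv ℝ f (x + s • v) v) s := by
  have hline : HasDerivAt (fun s : ℝ => x + s • v) v s := by
    simpa using ((hasDerivAt_id s).smul_const v).const_add x
  exact (hf _).hasFDerivAt.comp_hasDerivAt s hline

variable [CompleteSpace F]

theorem dslope_comp_add_smul_eq_integral {f : E → F} (hf : ContDiff ℝ 1 f) (x v : E) (r : ℝ) :
    dslope (fun s : ℝ => f (x + s • v)) 0 r =
      ∫ t in (0 : ℝ)..1, fderiv ℝ f (x + (t * r) • v) v := by
  have hderiv := hasDerivAt_comp_add_smul (hf.differentiable one_ne_zero) x v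
  rcases eq_or_ne r 0 with rfl | hr
  · simp [dslope_same, (hderiv 0).deriv]
  · have hcont : Continuous fun s : ℝ => fderiv ℝ f (x + s • v) v :=
      ((hf.continuous_fderiv one_ne_zero).comp (by fun_prop)).clm_apply continuous_const
    have hint := intervalIntegral.integral_eq_sub_of_hasDerivAt (a := 0) (b := r)
      (fun s _ => hderiv s) (hcont.intervalIntegrable _ _)
    rw [dslope_of_ne _ hr, slope_def_module, ← hint,
      intervalIntegral.integral_comp_mul_right (fun s => fderiv ℝ f (x + s • v) v) hr]
    simp

theorem continuous_dslope_comp_add_smul {f : E → F} (hf : ContDiff ℝ 1 f) :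
    Continuous fun y : ℝ × E × E => dslope (fun s : ℝ => f (y.2.1 + s • y.2.2)) 0 y.1 := by
  simp only [dslope_comp_add_smul_eq_integral hf]
  refine intervalIntegral.continuous_parametric_intervalIntegral_of_continuous' ?_ 0 1
  exact ((hf.continuous_fderiv one_ne_zero).comp (by fun_prop)).clm_apply (by fun_prop)

end DividedDifference

theorem exists_inner_eq_zero_chainCoord_eq {n : ℕ} (hn : 2 ≤ n) {k : ℕ} {x : S3}
    (hx : chainFun n k x = 0) (w : ℂ) :
    ∃ ξ : C2, inner ℝ (x : C2) ξ = 0 ∧ chainCoord n k ξ 0 = w := by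
  have hp : chainCoord n k x 0 = chainCos n := by rw [← sub_eq_zero, ← chainFun_eq, hx]
  have hq : ‖chainCoord n k x 1‖ ^ 2 ≠ 0 := by
    have hnorm := norm_sq_chainCoord n k x
    rw [hp, Complex.norm_real, Real.norm_eq_abs, sq_abs] at hnorm
    have hangle := (chainFun_angles n hn).2
    rw [← chainCos] at hangle
    linarith [Real.cos_le_one (Real.pi / n), hangle]
  refine ⟨(chainCoord n k).symm
    !₂[w, (-(chainCos n * w.re) / ‖chainCoord n k x 1‖ ^ 2) • chainCoord n k x 1], ?_, by simp⟩
  rw [← LinearIsometryEquiv.inner_map_map (chainCoord n k), LinearIsometryEquiv.apply_symm_apply,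
    PiLp.inner_apply, Fin.sum_univ_two]
  simp only [Matrix.cons_val_zero, Matrix.cons_val_one, Matrix.cons_val_fin_one, hp,
    inner_smul_right, real_inner_self_eq_norm_sq, Complex.inner, Complex.conj_ofReal,
    Complex.re_mul_ofReal]
  rw [div_mul_cancel₀ _ hq]
  ring

namespace TubeSystem

variable {ι : Type} {K : ι → Set S3} (T : TubeSystem K)

theorem exists_fderiv_tube_eq {j : ι} {y : ℂ × ℝ} {ξ : C2}
    (hξ : inner ℝ (T.tube j (y.1, Circle.exp y.2) : C2) ξ = 0) :
    ∃ η, fderiv ℝ (fun y : ℂ × ℝ => (T.tube j (y.1, Circle.exp y.2) : C2)) y η = ξ := by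
  have hnorm : ∀ y : ℂ × ℝ, ‖(T.tube j (y.1, Circle.exp y.2) : C2)‖ = 1 := fun y =>
    mem_sphere_zero_iff_norm.1 (T.tube j _).2
  have horth := inner_eq_zero_of_hasFDerivAt_of_norm_eq_one
    ((T.smooth j).differentiable (by simp) y).hasFDerivAt hnorm
  have hinj := injective_smul_add_smul_of_inner_eq_zero (T.immersion j y) (hnorm y) horth
  obtain ⟨⟨η, c⟩, h⟩ := (LinearMap.injective_iff_surjective_of_finrank_eq_finrank
    (by rw [finrank_C2, Module.finrank_prod, Module.finrank_self])).1 hinj ξ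
  replace h : fderiv ℝ (fun y : ℂ × ℝ => (T.tube j (y.1, Circle.exp y.2) : C2)) y η +
    c • (T.tube j (y.1, Circle.exp y.2) : C2) = ξ := h
  have hc : c = 0 := by
    rw [← h, inner_add_right, horth, inner_smul_right, real_inner_self_eq_norm_sq, hnorm] at hξ
    simpa using hξ
  exact ⟨η, by rw [← h, hc, zero_smul, add_zero]⟩

variable {T} in
theorem tube_mem_core_iff {j : ι} {u : ℂ} {v : Circle} : T.tube j (u, v) ∈ K j ↔ u = 0 := by
  rw [← T.core j]
  constructor
  · rintro ⟨w, hw⟩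
    exact (congrArg Prod.fst (T.injective j hw)).symm
  · rintro rfl
    exact ⟨v, rfl⟩

section Chain

theorem contDiff_chainFun_tube (n k : ℕ) (j : ι) :
    ContDiff ℝ ∞ fun y : ℂ × ℝ => chainFun n k (T.tube j (y.1, Circle.exp y.2)) := by
  simp only [chainFun_eq]
  exact (((EuclideanSpace.proj (0 : Fin 2)).restrictScalars ℝ).contDiff.comp
    ((chainCoord n k).contDiff.comp (T.smooth j))).sub contDiff_const

theorem fderiv_chainFun_tube (n k : ℕ) (j : ι) (y η : ℂ × ℝ) :
    fderiv ℝ (fun y : ℂ × ℝ => chainFun n k (T.tube j (y.1, Circle.exp y.2))) y η =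
      chainCoord n k
        (fderiv ℝ (fun y : ℂ × ℝ => (T.tube j (y.1, Circle.exp y.2) : C2)) y η) 0 := by
  have htube := ((T.smooth j).differentiable (by simp) y).hasFDerivAt
  simp only [chainFun_eq]
  have hcoord := (((EuclideanSpace.proj (0 : Fin 2) : C2 →L[ℂ] ℂ).restrictScalars ℝ).comp
    (chainCoord n k).toContinuousLinearEquiv.toContinuousLinearMap).hasFDerivAt.comp y htube
  exact congrArg (· η) (hcoord.sub_const (chainCos n : ℂ)).fderiv

/-- The function of the `k`-th component of the chain on the tube `j`, divided by the radius. -/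
def radialSlope (n k : ℕ) (j : ι) (y : unitInterval × (Circle × Circle)) : ℂ :=
  dslope (fun s : ℝ => chainFun n k (T.tube j (s • (y.2.1 : ℂ), y.2.2))) 0 y.1

theorem continuous_radialSlope (n k : ℕ) (j : ι) : Continuous (T.radialSlope n k j) := by
  have hlift : Continuous fun y : (unitInterval × Circle) × Circle =>
      T.radialSlope n k j (y.1.1, (y.1.2, y.2)) := by
    rw [(isOpenQuotientMap_prodMap_circleExp _).isQuotientMap.continuous_iff]
    have hslope := (continuous_dslope_comp_add_smul
      ((T.contDiff_chainFun_tube n k j).of_le (by norm_cast))).comp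
        (by fun_prop : Continuous fun y : (unitInterval × Circle) × ℝ =>
          ((y.1.1 : ℝ), ((0 : ℂ), y.2), ((y.1.2 : ℂ), (0 : ℝ))))
    refine hslope.congr fun y => ?_
    simp [radialSlope]
  exact hlift.comp (f := fun y : unitInterval × (Circle × Circle) => ((y.1, y.2.1), y.2.2))
    (by fun_prop)

variable {T} {n k : ℕ} {j : ι}

theorem smul_radialSlope (hK : K j = {x | chainFun n k x = 0}) (r : unitInterval)
    (θ v : Circle) :
    (r : ℝ) • T.radialSlope n k j (r, (θ, v)) = chainFun n k (T.tube j ((r : ℝ) • (θ : ℂ), v)) := by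
  have hcore : chainFun n k (T.tube j (0, v)) = 0 := by
    have hmem : T.tube j (0, v) ∈ K j := tube_mem_core_iff.2 rfl
    rwa [hK] at hmem
  have := sub_smul_dslope
    (fun s : ℝ => chainFun n k (T.tube j (s • (θ : ℂ), v))) 0 (r : ℝ)
  simpa only [radialSlope, sub_zero, zero_smul, hcore] using this

variable (T n k j) in
/-- The derivative at the core, along the meridian disk, of the function of the `k`-th component
of the chain on the tube `j`. -/
def meridianDeriv (v : Circle) : ℂ →L[ℝ] ℂ :=
  fderiv ℝ (fun u : ℂ => chainFun n k (T.tube j (u, v))) 0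

theorem radialSlope_zero (θ v : Circle) :
    T.radialSlope n k j (0, (θ, v)) = T.meridianDeriv n k j v θ := by
  obtain ⟨t, rfl⟩ := Circle.exp_surjective v
  have hdiff : Differentiable ℝ fun u : ℂ => chainFun n k (T.tube j (u, Circle.exp t)) :=
    ((T.contDiff_chainFun_tube n k j).differentiable (by simp)).comp
      (by fun_prop : Differentiable ℝ fun u : ℂ => (u, t))
  have hderiv := (hasDerivAt_comp_add_smul hdiff 0 θ 0).deriv
  simpa only [radialSlope, meridianDeriv, Set.Icc.coe_zero, dslope_same, zero_add, zero_smul]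
    using hderiv

theorem injective_meridianDeriv (hn : 2 ≤ n) (hK : K j = {x | chainFun n k x = 0}) (v : Circle) :
    Function.Injective (T.meridianDeriv n k j v) := by
  obtain ⟨t, rfl⟩ := Circle.exp_surjective v
  have hzero : ∀ s, chainFun n k (T.tube j (0, Circle.exp s)) = 0 := fun s => by
    have hmem : T.tube j (0, Circle.exp s) ∈ K j := tube_mem_core_iff.2 rfl
    rwa [hK] at hmem
  have hp := ((T.contDiff_chainFun_tube n k j).differentiable (by simp) (0, t)).hasFDerivAt
  set p' := fderiv ℝ (fun y : ℂ × ℝ => chainFun n k (T.tube j (y.1, Circle.exp y.2))) (0, t)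
    with hp'
  have hmeridian : T.meridianDeriv n k j (Circle.exp t) = p'.comp (.inl ℝ ℂ ℝ) := by
    have hcomp := HasFDerivAt.comp (0 : ℂ) hp (hasFDerivAt_prodMk_left (𝕜 := ℝ) (0 : ℂ) t)
    exact hcomp.fderiv
  have hlongitude : p' (0, 1) = 0 := by
    have := hp.comp_hasDerivAt t ((hasDerivAt_const t (0 : ℂ)).prodMk (hasDerivAt_id t))
    exact this.unique ((hasDerivAt_const t 0).congr_of_eventuallyEq (.of_forall hzero))
  refine LinearMap.injective_iff_surjective.2 fun w => ?_
  obtain ⟨ξ, hξ, hw⟩ := exists_inner_eq_zero_chainCoord_eq hn (hzero t) w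
  obtain ⟨⟨u, s⟩, hη⟩ := T.exists_fderiv_tube_eq (y := (0, t)) hξ
  refine ⟨u, ?_⟩
  have hsplit : (u, s) = (u, (0 : ℝ)) + s • ((0 : ℂ), (1 : ℝ)) := by simp
  rw [← hw, ← hη, ← fderiv_chainFun_tube, ← hp', hsplit, map_add, map_smul, hlongitude, smul_zero,
    add_zero, hmeridian]
  rfl

theorem radialSlope_ne_zero (hn : 2 ≤ n) (hK : K j = {x | chainFun n k x = 0})
    (y : unitInterval × (Circle × Circle)) : T.radialSlope n k j y ≠ 0 := by
  obtain ⟨r, θ, v⟩ := y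
  intro h
  rcases eq_or_ne r 0 with rfl | hr
  · rw [radialSlope_zero] at h
    exact θ.coe_ne_zero (injective_meridianDeriv hn hK v (h.trans (map_zero _).symm))
  · have hmem : T.tube j ((r : ℝ) • (θ : ℂ), v) ∈ K j := by
      rw [hK, Set.mem_ofPred_eq, ← smul_radialSlope hK, h, smul_zero]
    exact smul_ne_zero (unitInterval.coe_ne_zero.2 hr) θ.coe_ne_zero (tube_mem_core_iff.1 hmem)

end Chain

end TubeSystem

/-! ### Filling a tube in polar coordinates -/

/-- Polar coordinates on the solid torus: radius, meridian angle and longitude angle. -/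
def polar (y : unitInterval × (Circle × Circle)) : Disk × Circle :=
  (⟨(y.1 : ℝ) • (y.2.1 : ℂ), by
    simpa [norm_smul, abs_of_nonneg y.1.2.1, Circle.norm_coe] using y.1.2.2⟩, y.2.2)

theorem surjective_polar : Function.Surjective polar := by
  rintro ⟨⟨w, hw⟩, v⟩
  refine ⟨(⟨‖w‖, norm_nonneg w, mem_closedBall_zero_iff.1 hw⟩, (dir w, v)), ?_⟩
  simp only [polar, norm_smul_dir]

theorem isQuotientMap_polar : Topology.IsQuotientMap polar := by
  refine .of_surjective_continuous surjective_polar ?_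
  unfold polar
  fun_prop

theorem polar_one (p : Circle × Circle) : polar (1, p) = (diskBoundary p.1, p.2) := by
  simp [polar, diskBoundary]

theorem polar_zero (p : Circle × Circle) : polar (0, p) = (diskCentre, p.2) := by
  simp [polar, diskCentre]

theorem fst_eq_of_polar_eq {y y' : unitInterval × (Circle × Circle)} (h : polar y = polar y') :
    y.1 = y'.1 := by
  have hnorm := congrArg (fun z : Disk × Circle => ‖(z.1 : ℂ)‖) h
  simp only [polar, norm_smul, Circle.norm_coe, mul_one, Real.norm_of_nonneg y.1.2.1,
    Real.norm_of_nonneg y'.1.2.1] at hnorm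
  exact Subtype.ext hnorm

theorem eq_of_polar_eq {y y' : unitInterval × (Circle × Circle)} (h : polar y = polar y')
    (hy : y.1 ≠ 0) : y = y' := by
  have hfst := fst_eq_of_polar_eq h
  have hdisk : (y.1 : ℝ) • (y.2.1 : ℂ) = (y'.1 : ℝ) • (y'.2.1 : ℂ) :=
    congrArg (fun z : Disk × Circle => (z.1 : ℂ)) h
  rw [← hfst] at hdisk
  have hangle := Circle.ext (smul_right_injective ℂ (unitInterval.coe_ne_zero.2 hy) hdisk)
  exact Prod.ext hfst (Prod.ext hangle (congrArg (fun z : Disk × Circle => z.2) h))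

theorem exists_polar_factor {Z : Type*} [TopologicalSpace Z]
    {Γ : unitInterval × (Circle × Circle) → Z} (hΓ : Continuous Γ) {m : Circle → Z}
    (h0 : ∀ p, Γ (0, p) = m p.2) :
    ∃ G : Disk × Circle → Z, Continuous G ∧ ∀ y, G (polar y) = Γ y := by
  have hfactor : Γ.FactorsThrough polar := by
    rintro ⟨r, p⟩ ⟨r', p'⟩ h
    rcases eq_or_ne r 0 with rfl | hr
    · obtain rfl : 0 = r' := fst_eq_of_polar_eq h
      rw [h0, h0]
      exact congrArg (fun z => m z.2) h
    · rw [eq_of_polar_eq h hr]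
  have hpolar : Topology.IsQuotientMap (⟨polar, isQuotientMap_polar.continuous⟩ : C(_, _)) :=
    isQuotientMap_polar
  exact ⟨hpolar.lift ⟨Γ, hΓ⟩ hfactor, map_continuous _,
    DFunLike.congr_fun (hpolar.lift_comp ⟨Γ, hΓ⟩ hfactor)⟩

namespace TubeSystem

variable {ι : Type} {K : ι → Set S3} {T : TubeSystem K} {j : ι}

variable (T j) in
/-- The `j`-th closed tube in polar coordinates. -/
def polarTube (y : unitInterval × (Circle × Circle)) : S3 :=
  T.tube j ((y.1 : ℝ) • (y.2.1 : ℂ), y.2.2)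

theorem continuous_polarTube : Continuous (T.polarTube j) :=
  (T.continuous_tube j).comp (by fun_prop)

theorem polarTube_mem_closedTube (y : unitInterval × (Circle × Circle)) :
    T.polarTube j y ∈ T.closedTube j :=
  T.tube_mem_closedTube j (polar y)

theorem range_polarTube : Set.range (T.polarTube j) = T.closedTube j := by
  rw [← range_tube_disk, ← surjective_polar.range_comp]
  rfl

theorem polarTube_mem_core_iff {y : unitInterval × (Circle × Circle)} :
    T.polarTube j y ∈ K j ↔ y.1 = 0 := by
  rw [polarTube, tube_mem_core_iff, smul_eq_zero, or_iff_left y.2.1.coe_ne_zero,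
    Set.Icc.coe_eq_zero]

theorem polar_eq_of_polarTube_eq {y y' : unitInterval × (Circle × Circle)}
    (h : T.polarTube j y = T.polarTube j y') : polar y = polar y' := by
  have htube := Prod.ext_iff.1 (T.injective j h)
  exact Prod.ext (Subtype.ext htube.1) htube.2

section Filling

variable {f : S3 → S3} {h : unitInterval × (Circle × Circle) → Circle × Circle}
  {G : Disk × Circle → S3} {m : Circle → S3} (hfK : f '' K j = K j)
  (hG : ∀ r ≠ 0, ∀ p, G (polar (r, p)) = f (T.polarTube j (r, h (r, p))))
  (hG0 : ∀ v, G (diskCentre, v) = m v) (hm : Set.range m = K j)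

include hfK hG hG0 hm

theorem mem_core_polar_iff (hf : Function.Injective f) (y : unitInterval × (Circle × Circle)) :
    G (polar y) ∈ K j ↔ y.1 = 0 := by
  obtain ⟨r, p⟩ := y
  rcases eq_or_ne r 0 with rfl | hr
  · rw [polar_zero, hG0, ← hm]
    exact iff_of_true (Set.mem_range_self _) rfl
  · rw [hG r hr, ← hfK, hf.mem_set_image, polarTube_mem_core_iff]

theorem injective_of_polar (hf : Function.Injective f)
    (hh : ∀ r, Function.Injective fun p => h (r, p)) (hminj : Function.Injective m) :
    Function.Injective G := by
  intro z z' hz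
  obtain ⟨⟨r, p⟩, rfl⟩ := surjective_polar z
  obtain ⟨⟨r', p'⟩, rfl⟩ := surjective_polar z'
  have hiff : r = 0 ↔ r' = 0 := by
    rw [← mem_core_polar_iff hfK hG hG0 hm hf (r, p), hz,
      mem_core_polar_iff hfK hG hG0 hm hf (r', p')]
  rcases eq_or_ne r 0 with rfl | hr
  · obtain rfl := hiff.1 rfl
    simp only [polar_zero, hG0] at hz ⊢
    rw [hminj hz]
  · rw [hG r hr, hG r' (hr ∘ hiff.2)] at hz
    have heq := Prod.ext_iff.1 (eq_of_polar_eq (polar_eq_of_polarTube_eq (hf hz)) hr)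
    obtain rfl : r = r' := heq.1
    rw [hh r heq.2]

theorem range_eq_of_polar (hh : ∀ r, Function.Surjective fun p => h (r, p)) :
    Set.range G = f '' T.closedTube j := by
  have hcore : Set.range m ⊆ f '' T.closedTube j := by
    rw [hm, ← hfK]
    exact Set.image_mono (T.core_subset_closedTube j)
  refine (Set.range_subset_iff.2 fun z => ?_).antisymm ?_
  · obtain ⟨⟨r, p⟩, rfl⟩ := surjective_polar z
    rcases eq_or_ne r 0 with rfl | hr
    · rw [polar_zero, hG0]
      exact hcore (Set.mem_range_self _)
    · rw [hG r hr]
      exact Set.mem_image_of_mem f (polarTube_mem_closedTube _)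
  · rw [← range_polarTube]
    rintro _ ⟨_, ⟨⟨r, q⟩, rfl⟩, rfl⟩
    rcases eq_or_ne r 0 with rfl | hr
    · have hmem : f (T.polarTube j (0, q)) ∈ Set.range m := by
        rw [hm, ← hfK]
        exact Set.mem_image_of_mem f (polarTube_mem_core_iff.2 rfl)
      obtain ⟨v, hv⟩ := hmem
      exact ⟨_, (hG0 v).trans hv⟩
    · obtain ⟨p, rfl⟩ := hh r q
      exact ⟨_, hG r hr p⟩

end Filling

theorem exists_isFilling_of_polar {f : S3 → S3} {τ : unitInterval × (Circle × Circle) → S3}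
    {h : unitInterval × (Circle × Circle) → Circle × Circle} {m : Circle → S3}
    (hf : Function.Injective f) (hfK : f '' K j = K j) (hτ : Continuous τ)
    (hτf : ∀ r ≠ 0, ∀ p, τ (r, p) = f (T.polarTube j (r, p))) (hh : Continuous h)
    (hbij : ∀ r, Function.Bijective fun p => h (r, p)) (hh1 : ∀ p, h (1, p) = p.swap)
    (hminj : Function.Injective m) (hm : Set.range m = K j) (hτm : ∀ p, τ (0, h (0, p)) = m p.2) :
    ∃ G, T.IsFilling f j Prod.swap G := by
  obtain ⟨G, hGcont, hG⟩ := exists_polar_factor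
    (Γ := fun y => τ (y.1, h y)) (hτ.comp (continuous_fst.prodMk hh)) hτm
  have hGf : ∀ r ≠ 0, ∀ p, G (polar (r, p)) = f (T.polarTube j (r, h (r, p))) :=
    fun r hr p => (hG _).trans (hτf r hr _)
  have hG0 : ∀ v, G (diskCentre, v) = m v := fun v => by
    rw [← polar_zero (1, v), hG, hτm]
  refine ⟨G, hGcont, injective_of_polar hfK hGf hG0 hm hf (fun r => (hbij r).1) hminj, fun p => ?_,
    range_eq_of_polar hfK hGf hG0 hm fun r => (hbij r).2, ?_⟩
  · rw [← polar_one, hGf 1 one_ne_zero, hh1, polarTube, Set.Icc.coe_one, one_smul]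
    rfl
  · simp only [hG0, hm, hfK]

end TubeSystem

/-! ### Isotopies of the torus -/

theorem exists_lift_of_isotopy {X : Type*} [TopologicalSpace X] [CompactSpace X] [T2Space X]
    {A : unitInterval × X → X} (hA : Continuous A)
    (hbij : ∀ t, Function.Bijective fun x => A (t, x)) :
    ∃ h : unitInterval × X → X, Continuous h ∧ (∀ t, Function.Bijective fun x => h (t, x)) ∧
      (∀ t x, A (1, h (t, x)) = A (t, x)) ∧ ∀ x, h (1, x) = x := by
  let e : X ≃ₜ X := (isHomeomorph_iff_continuous_bijective.2
    ⟨hA.comp (by fun_prop : Continuous fun x => ((1 : unitInterval), x)), hbij 1⟩).homeomorph _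
  exact ⟨fun y => e.symm (A y), e.symm.continuous.comp hA, fun t => e.symm.bijective.comp (hbij t),
    fun t x => e.apply_symm_apply _, e.symm_apply_apply⟩

theorem bijective_dir_linear {A : ℂ →ₗ[ℝ] ℂ} (hA : Function.Injective A) :
    Function.Bijective fun θ : Circle => dir (A θ) := by
  have hpos : ∀ θ : Circle, 0 < ‖A θ‖ := fun θ =>
    norm_pos_iff.2 fun h => θ.coe_ne_zero (hA (h.trans (map_zero A).symm))
  constructor
  · intro θ θ' (h : dir (A θ) = dir (A θ'))
    have hmul : A (‖A θ'‖ • (θ : ℂ)) = A (‖A θ‖ • (θ' : ℂ)) := by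
      rw [map_smul, map_smul, ← norm_smul_dir (A θ), ← norm_smul_dir (A θ'), h]
      simp only [norm_smul, norm_norm, Circle.norm_coe, mul_one]
      exact smul_comm _ _ _
    rw [← dir_smul_circle (hpos θ') θ, hA hmul, dir_smul_circle (hpos θ)]
  · intro w
    obtain ⟨z, hz⟩ := LinearMap.injective_iff_surjective.1 hA w
    have hz0 : z ≠ 0 := by
      rintro rfl
      exact w.coe_ne_zero (hz.symm.trans (map_zero A))
    refine ⟨dir z, ?_⟩
    change dir (A (dir z)) = w
    rw [← dir_smul (norm_pos_iff.2 hz0), ← map_smul, norm_smul_dir, hz, ← one_smul ℝ (w : ℂ),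
      dir_smul_circle one_pos]

/-- The real-linear map of `ℂ` that takes `1` to `p` and `I` to `x`. -/
def linearOfBasis (p x : ℂ) : ℂ →ₗ[ℝ] ℂ := Complex.reLm.smulRight p + Complex.imLm.smulRight x

theorem linearOfBasis_apply (p x z : ℂ) : linearOfBasis p x z = z.re • p + z.im • x := rfl

theorem linearOfBasis_apply_basis (l : ℂ →L[ℝ] ℂ) (z : ℂ) :
    linearOfBasis (l 1) (l Complex.I) z = l z := by
  rw [linearOfBasis_apply, ← map_smul, ← map_smul, ← map_add]
  simp

theorem injective_linearOfBasis_ofReal_iff {p : ℝ} {x : ℂ} :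
    Function.Injective (linearOfBasis p x) ↔ p ≠ 0 ∧ x.im ≠ 0 := by
  rw [injective_iff_map_eq_zero]
  constructor
  · refine fun h => ⟨fun hp => ?_, fun hx => ?_⟩
    · exact one_ne_zero (h 1 (by simp [linearOfBasis_apply, hp]))
    · have hp := congrArg Complex.im (h (x.re - p * Complex.I) (by
        refine Complex.ext ?_ ?_ <;> simp [linearOfBasis_apply, hx, mul_comm]))
      have hone := congrArg Complex.re (h 1 (by simpa [linearOfBasis_apply] using hp))
      simp at hone
  · rintro ⟨hp, hx⟩ z hz
    have him : z.im = 0 := by simpa [linearOfBasis_apply, hx] using congrArg Complex.im hz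
    refine Complex.ext ?_ him
    simpa [linearOfBasis_apply, him, hp] using hz

theorem exists_forall_mul_pos {X : Type*} [TopologicalSpace X] [PreconnectedSpace X] [Nonempty X]
    {f : X → ℝ} (hf : Continuous f) (h0 : ∀ x, f x ≠ 0) : ∃ ε : ℝ, ∀ x, 0 < ε * f x := by
  have hne : ¬∃ x, f x = 0 := fun ⟨x, hx⟩ => h0 x hx
  obtain ⟨a⟩ := ‹Nonempty X›
  refine ⟨f a, fun x => not_le.1 fun hx => hne ?_⟩
  rcases mul_nonpos_iff.1 hx with ⟨ha, hx⟩ | ⟨ha, hx⟩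
  · exact mem_range_of_exists_le_of_exists_ge hf ⟨x, hx⟩ ⟨a, ha⟩
  · exact mem_range_of_exists_le_of_exists_ge hf ⟨a, ha⟩ ⟨x, hx⟩

section LinearIsotopy

variable {l : Circle → ℂ →L[ℝ] ℂ} {σ : Circle → ℝ}

theorem exp_neg_mul_apply_one (hσ : ∀ v, Circle.exp (σ v) = dir (l v 1)) (v : Circle) :
    (Circle.exp (-σ v) : ℂ) * l v 1 = (‖l v 1‖ : ℝ) := by
  conv_lhs => rw [← norm_smul_dir (l v 1), ← hσ v, mul_smul_comm, ← Circle.coe_mul, Circle.exp_neg,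
    inv_mul_cancel]
  simp

theorem exp_neg_mul_eq_linearOfBasis (hσ : ∀ v, Circle.exp (σ v) = dir (l v 1)) (v : Circle)
    (z : ℂ) : (Circle.exp (-σ v) : ℂ) * l v z =
      linearOfBasis (‖l v 1‖ : ℝ) (Circle.exp (-σ v) * l v Complex.I) z := by
  rw [← linearOfBasis_apply_basis, linearOfBasis_apply, linearOfBasis_apply,
    ← exp_neg_mul_apply_one hσ, mul_add, mul_smul_comm, mul_smul_comm]

theorem exists_continuous_injective_linear_isotopy (hl : ∀ v, Function.Injective (l v))
    (hcont : Continuous fun y : Circle × Circle => l y.2 y.1) (hσcont : Continuous σ)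
    (hσ : ∀ v, Circle.exp (σ v) = dir (l v 1)) :
    ∃ (A : unitInterval × Circle → ℂ →ₗ[ℝ] ℂ) (R : ℂ →ₗ[ℝ] ℂ),
      (Continuous fun y : unitInterval × (Circle × Circle) => A (y.1, y.2.2) y.2.1) ∧
      (∀ y, Function.Injective (A y)) ∧ (∀ v, A (0, v) = R) ∧
      ∀ v z, A (1, v) z = Circle.exp (-σ v) * l v z := by
  set x : Circle → ℂ := fun v => Circle.exp (-σ v) * l v Complex.I with hx
  have hone : Continuous fun v => l v 1 :=
    hcont.comp (by fun_prop : Continuous fun v : Circle => ((1 : Circle), v))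
  have hI : Continuous fun v => l v Complex.I := hcont.comp (by fun_prop :
    Continuous fun v : Circle =>
      ((⟨Complex.I, mem_sphere_zero_iff_norm.2 Complex.norm_I⟩ : Circle), v))
  have hxcont : Continuous x := by fun_prop
  have htriangular : ∀ v, ‖l v 1‖ ≠ 0 ∧ (x v).im ≠ 0 := fun v => by
    rw [← injective_linearOfBasis_ofReal_iff]
    refine fun z w hzw => hl v (mul_left_cancel₀ (Circle.exp (-σ v)).coe_ne_zero ?_)
    rwa [exp_neg_mul_eq_linearOfBasis hσ v z, exp_neg_mul_eq_linearOfBasis hσ v w]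
  obtain ⟨ε, hε⟩ := exists_forall_mul_pos (Complex.continuous_im.comp hxcont)
    fun v => (htriangular v).2
  refine ⟨fun y => linearOfBasis ((y.1 * ‖l y.2 1‖ + (1 - y.1) : ℝ))
    (y.1 * x y.2 + (1 - y.1) * (ε * Complex.I)), linearOfBasis 1 (ε * Complex.I), ?_, fun y => ?_,
    fun v => by simp, fun v z => ?_⟩
  · simp only [linearOfBasis_apply]
    fun_prop
  · have hpos : ∀ {a b : ℝ}, 0 < a → 0 < b → 0 < y.1 * a + (1 - y.1) * b := fun ha hb => by
      rcases eq_or_lt_of_le y.1.2.1 with h0 | h0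
      · simpa [← h0] using hb
      · exact add_pos_of_pos_of_nonneg (mul_pos h0 ha) (mul_nonneg (sub_nonneg.2 y.1.2.2) hb.le)
    refine injective_linearOfBasis_ofReal_iff.2 ⟨ne_of_gt ?_, fun him => ?_⟩
    · simpa using hpos (norm_pos_iff.2 (norm_ne_zero_iff.1 (htriangular y.2).1)) one_pos
    · have hε0 : ε ≠ 0 := left_ne_zero_of_mul (hε 1).ne'
      refine (hpos (hε y.2) (mul_self_pos.2 hε0)).ne' ?_
      replace him : y.1 * (x y.2).im + (1 - y.1) * ε = 0 := by simpa using him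
      simp only [Function.comp_apply]
      linear_combination ε * him
  · rw [exp_neg_mul_eq_linearOfBasis hσ]
    simp [hx]

theorem exists_fibrewise_isotopy (hl : ∀ v, Function.Injective (l v))
    (hcont : Continuous fun y : Circle × Circle => l y.2 y.1) (hσcont : Continuous σ)
    (hσ : ∀ v, Circle.exp (σ v) = dir (l v 1)) {c : Circle → Circle} (hc : Continuous c)
    (hcbij : Function.Bijective c) :
    ∃ (B : unitInterval × (Circle × Circle) → Circle × Circle) (κ : Circle → Circle),
      Continuous B ∧ (∀ t, Function.Bijective fun y => B (t, y)) ∧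
      (∀ p, B (1, p) = (dir (l p.2 p.1), c p.2)) ∧ ∀ p, B (0, p) = (κ p.1, c p.2) := by
  obtain ⟨A, R, hA, hinj, hA0, hA1⟩ :=
    exists_continuous_injective_linear_isotopy hl hcont hσcont hσ
  have hne : ∀ y (θ : Circle), A y θ ≠ 0 := fun y θ h =>
    θ.coe_ne_zero (hinj y (h.trans (map_zero _).symm))
  have hfibre : ∀ (t : unitInterval) (v : Circle),
      Function.Bijective fun θ : Circle => Circle.exp (t * σ v) * dir (A (t, v) θ) := fun t v =>
    (Group.mulLeft_bijective _).comp (bijective_dir_linear (hinj (t, v)))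
  refine ⟨fun y => (Circle.exp (y.1 * σ y.2.2) * dir (A (y.1, y.2.2) y.2.1), c y.2.2),
    fun θ => dir (R θ), ?_, fun t => ⟨?_, ?_⟩, fun p => ?_, fun p => ?_⟩
  · have hdir := continuous_dir_comp hA fun y => hne _ _
    fun_prop
  · rintro ⟨θ, v⟩ ⟨θ', v'⟩ h
    obtain ⟨hθ, hv⟩ := Prod.ext_iff.1 h
    have hvv : v = v' := hcbij.1 hv
    subst hvv
    exact Prod.ext ((hfibre t v).1 hθ) rfl
  · rintro ⟨α, w⟩
    obtain ⟨v, rfl⟩ := hcbij.2 w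
    obtain ⟨θ, rfl⟩ := (hfibre t v).2 α
    exact ⟨(θ, v), rfl⟩
  · have hl0 : 0 < ‖l p.2 p.1‖ :=
      norm_pos_iff.2 fun h => p.1.coe_ne_zero (hl p.2 (h.trans (map_zero _).symm))
    simp only [Set.Icc.coe_one, one_mul, hA1, Prod.mk.injEq, and_true]
    rw [← norm_smul_dir (l p.2 p.1), mul_smul_comm, ← Circle.coe_mul, dir_smul_circle hl0,
      dir_smul_circle hl0, ← mul_assoc, ← Circle.exp_add, add_neg_cancel, Circle.exp_zero, one_mul]
  · simp [hA0]

end LinearIsotopy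

/-! ### Filling in the image of a tube around a component of a Hopf link -/

namespace TubeSystem

variable {ι : Type} {K : ι → Set S3}

/-- A factorization, in polar coordinates on the `j`-th tube, of the first function of a frame as
the radius times a function without zeros: it extends the angles of the frame to the real blow-up of
the core. -/
structure BlowUp (T : TubeSystem K) (H : HopfFrame) (j : ι) where
  slope : unitInterval × (Circle × Circle) → ℂ
  continuous_slope : Continuous slope
  slope_ne_zero : ∀ y, slope y ≠ 0
  smul_slope : ∀ y, H.a (T.polarTube j y) = (y.1 : ℝ) • slope y
  b_ne_zero : ∀ y, H.b (T.polarTube j y) ≠ 0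

namespace BlowUp

variable {T : TubeSystem K} {H : HopfFrame} {j : ι} (D : T.BlowUp H j)

/-- The extension of the angles of the frame to the blow-up. -/
def angles (y : unitInterval × (Circle × Circle)) : Circle × Circle :=
  (dir (D.slope y), dir (H.b (T.polarTube j y)))

theorem continuous_angles : Continuous D.angles :=
  (continuous_dir_comp D.continuous_slope D.slope_ne_zero).prodMk
    (continuous_dir_comp (H.continuous_b.comp continuous_polarTube) D.b_ne_zero)

/-- The extension to the blow-up of the map of `S³` that acts by `g` on the tori. -/
def torusMap (g : Circle × Circle → Circle × Circle) (y : unitInterval × (Circle × Circle)) : S3 :=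
  H.inv ((y.1 * ‖D.slope y‖) • ((g (D.angles y)).1 : ℂ),
    ‖H.b (T.polarTube j y)‖ • ((g (D.angles y)).2 : ℂ))

variable {g : Circle × Circle → Circle × Circle}

theorem continuous_torusMap (hg : Continuous g) : Continuous (D.torusMap g) := by
  have hangles := hg.comp D.continuous_angles
  have hslope := D.continuous_slope
  have hb : Continuous fun y => H.b (T.polarTube j y) := H.continuous_b.comp continuous_polarTube
  refine H.continuousOn_inv.comp_continuous
    (((by fun_prop : Continuous fun y => (y.1 : ℝ) * ‖D.slope y‖).smul
      (continuous_subtype_val.comp hangles.fst)).prodMk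
      (hb.norm.smul (continuous_subtype_val.comp hangles.snd))) fun y h => ?_
  exact smul_ne_zero (norm_ne_zero_iff.2 (D.b_ne_zero y)) (Circle.coe_ne_zero _)
    (congrArg Prod.snd h)

theorem torusMap_of_ne_zero {r : unitInterval} (hr : r ≠ 0) (p : Circle × Circle) :
    D.torusMap g (r, p) = H.torusMap g (T.polarTube j (r, p)) := by
  have hr' : 0 < (r : ℝ) := unitInterval.pos_iff_ne_zero.2 hr
  have ha := D.smul_slope (r, p)
  have hangles : H.angles (T.polarTube j (r, p)) = D.angles (r, p) := by
    rw [HopfFrame.angles, ha, dir_smul hr', angles]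
  rw [HopfFrame.torusMap_of_ne_zero (ha ▸ smul_ne_zero hr'.ne' (D.slope_ne_zero _))
    (D.b_ne_zero _), hangles, ha, norm_smul, Real.norm_of_nonneg hr'.le]
  rfl

theorem torusMap_zero (p : Circle × Circle) :
    D.torusMap g (0, p) = H.inv (0, (g (D.angles (0, p))).2) := by
  rw [torusMap, Set.Icc.coe_zero, zero_mul, zero_smul,
    ← H.inv_smul (norm_pos_iff.2 (D.b_ne_zero (0, p))) (HopfFrame.mk_zero_coe_ne_zero _),
    Prod.smul_mk, smul_zero]

theorem exists_isFilling (hK : K j = {x | H.a x = 0}) (hg : Continuous g)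
    (hgbij : Function.Bijective g) {A : unitInterval × (Circle × Circle) → Circle × Circle}
    {χ₁ χ₂ : Circle → Circle} (hA : Continuous A)
    (hAbij : ∀ t, Function.Bijective fun p => A (t, p))
    (hA1 : ∀ p, A (1, p) = g (D.angles (0, p.swap))) (hA0 : ∀ p, A (0, p) = (χ₁ p.1, χ₂ p.2)) :
    ∃ G, T.IsFilling (H.torusMap g) j Prod.swap G := by
  obtain ⟨h, hh, hhbij, hAh, hh1⟩ := exists_lift_of_isotopy hA hAbij
  have hχ : Function.Bijective χ₂ := by
    have hmap : Function.Bijective (Prod.map χ₁ χ₂) := by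
      have hA0' : Prod.map χ₁ χ₂ = fun p => A (0, p) := funext fun p => (hA0 p).symm
      exact hA0' ▸ hAbij 0
    exact (Prod.map_bijective.1 hmap).2
  refine exists_isFilling_of_polar (HopfFrame.bijective_torusMap hgbij).1
    (HopfFrame.image_torusMap_of_eq_zero fun x hx => Or.inl (hK.subset hx))
    (D.continuous_torusMap hg) (fun r hr p => D.torusMap_of_ne_zero hr p)
    (continuous_swap.comp hh) (fun r => Prod.swap_bijective.comp (hhbij r))
    (fun p => congrArg Prod.swap (hh1 p))
    ((HopfFrame.injective_inv_zero_circle (H := H)).comp hχ.1) ?_ fun p => ?_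
  · rw [hχ.2.range_comp fun v : Circle => H.inv (0, v), HopfFrame.range_inv_zero_circle, hK]
  · rw [torusMap_zero, Function.comp_apply, ← hA1, hAh, hA0]
    rfl

end BlowUp

section Core

variable {T : TubeSystem K} {H : HopfFrame} {j : ι} (hK : K j = {x | H.a x = 0})

include hK

theorem a_tube_zero (v : Circle) : H.a (T.tube j (0, v)) = 0 :=
  hK.subset (tube_mem_core_iff.2 rfl)

theorem inv_dir_b_tube_zero (v : Circle) :
    H.inv (0, dir (H.b (T.tube j (0, v)))) = T.tube j (0, v) := by
  have ha := a_tube_zero (T := T) hK v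
  exact HopfFrame.inv_eq_of_eq_smul (norm_pos_iff.2 (HopfFrame.b_ne_zero_of_a_eq_zero ha))
    (ha.trans (smul_zero _).symm) (norm_smul_dir _).symm

theorem continuous_dir_b_tube_zero : Continuous fun v => dir (H.b (T.tube j (0, v))) :=
  continuous_dir_comp (H.continuous_b.comp ((T.continuous_tube j).comp (by fun_prop)))
    fun v => HopfFrame.b_ne_zero_of_a_eq_zero (a_tube_zero hK v)

theorem bijective_dir_b_tube_zero : Function.Bijective fun v => dir (H.b (T.tube j (0, v))) := by
  constructor
  · intro v w (h : dir (H.b (T.tube j (0, v))) = dir (H.b (T.tube j (0, w))))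
    have htube := inv_dir_b_tube_zero (T := T) hK v
    rw [h, inv_dir_b_tube_zero hK w] at htube
    exact (Prod.ext_iff.1 (T.injective j htube)).2.symm
  · intro w
    have hw : H.inv (0, w) ∈ K j := by
      rw [hK, ← HopfFrame.range_inv_zero_circle]
      exact Set.mem_range_self w
    rw [← T.core j] at hw
    obtain ⟨v, hv⟩ := hw
    exact ⟨v, HopfFrame.injective_inv_zero_circle ((inv_dir_b_tube_zero hK v).trans hv)⟩

end Core

theorem exists_exp_eq_dir_meridianDeriv {T : TubeSystem K} {n k : ℕ} {j : ι} (hn : 2 ≤ n)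
    (hK : K j = {x | chainFun n k x = 0}) :
    ∃ σ : C(Circle, ℝ), ∀ v, Circle.exp (σ v) = dir (T.meridianDeriv n k j v 1) := by
  have hmem : ∀ v, T.tube j (1, v) ∈ (K j)ᶜ := fun v h => one_ne_zero (tube_mem_core_iff.1 h)
  have hdir : Continuous fun x : ↥(K j)ᶜ => dir (chainFun n k x) :=
    continuous_dir_comp ((continuous_chainFun n k).comp continuous_subtype_val)
      fun x h => x.2 (hK.symm.subset h)
  have hslope := continuous_dir_comp (T.continuous_radialSlope n k j) (radialSlope_ne_zero hn hK)
  obtain ⟨σ, hσ⟩ := (T.preferred j).exists_arg ⟨_, hdir⟩ hmem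
  obtain ⟨σ', hσ'⟩ := exists_arg_of_homotopy
    ⟨fun y => dir (T.radialSlope n k j (unitInterval.symm y.1, (1, y.2))),
      hslope.comp (by fun_prop)⟩ σ fun v => by
    have hone := smul_radialSlope (T := T) hK 1 1 v
    rw [Set.Icc.coe_one, one_smul, one_smul] at hone
    simp only [hσ, ContinuousMap.coe_mk, unitInterval.symm_zero, hone, Circle.coe_one]
  refine ⟨σ', fun v => ?_⟩
  simp only [hσ', ContinuousMap.coe_mk, unitInterval.symm_one, radialSlope_zero, Circle.coe_one]

section ChainBlowUp

variable (T : TubeSystem K) {n k : ℕ} {H : HopfFrame} {j j' : ι}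

/-- The blow-up of the core of a tube around a component of the chain: the slope is the derivative
along the rays of the meridian disks. -/
def chainBlowUp (hn : 2 ≤ n) (hHa : H.a = chainFun n k) (hj : K j = {x | H.a x = 0})
    (hj' : K j' = {x | H.b x = 0}) (hne : j ≠ j') : T.BlowUp H j where
  slope := T.radialSlope n k j
  continuous_slope := T.continuous_radialSlope n k j
  slope_ne_zero := radialSlope_ne_zero hn (hHa ▸ hj)
  smul_slope y := by
    rw [hHa]
    exact (smul_radialSlope (hHa ▸ hj) y.1 y.2.1 y.2.2).symm
  b_ne_zero y h := Set.disjoint_left.1 (T.disjoint_core_closedTube hne.symm)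
    (hj'.symm.subset h) (polarTube_mem_closedTube y)

theorem exists_isotopy_chainBlowUp_angles (hn : 2 ≤ n) (hHa : H.a = chainFun n k)
    (hj : K j = {x | H.a x = 0}) (hj' : K j' = {x | H.b x = 0}) (hne : j ≠ j') :
    ∃ (B : unitInterval × (Circle × Circle) → Circle × Circle) (κ c : Circle → Circle),
      Continuous B ∧ (∀ t, Function.Bijective fun p => B (t, p)) ∧
      (∀ p, B (1, p) = (T.chainBlowUp hn hHa hj hj' hne).angles (0, p)) ∧
      ∀ p, B (0, p) = (κ p.1, c p.2) := by
  have hK : K j = {x | chainFun n k x = 0} := hHa ▸ hj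
  obtain ⟨σ, hσ⟩ := exists_exp_eq_dir_meridianDeriv (T := T) hn hK
  have hcont : Continuous fun y : Circle × Circle => T.meridianDeriv n k j y.2 y.1 := by
    simp only [← radialSlope_zero]
    exact (T.continuous_radialSlope n k j).comp (by fun_prop)
  obtain ⟨B, κ, hB, hbij, hB1, hB0⟩ := exists_fibrewise_isotopy (injective_meridianDeriv hn hK)
    hcont σ.continuous hσ (continuous_dir_b_tube_zero hj) (bijective_dir_b_tube_zero hj)
  refine ⟨B, κ, fun v => dir (H.b (T.tube j (0, v))), hB, hbij, fun p => (hB1 p).trans ?_, hB0⟩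
  simp [BlowUp.angles, chainBlowUp, ← radialSlope_zero, polarTube]

theorem exists_isFilling_torusMap (hn : 2 ≤ n) (hHa : H.a = chainFun n k)
    (hj : K j = {x | H.a x = 0}) (hj' : K j' = {x | H.b x = 0}) (hne : j ≠ j')
    {g : unitInterval × (Circle × Circle) → Circle × Circle} (hg : Continuous g)
    (hgbij : ∀ t, Function.Bijective fun p => g (t, p)) {χ₁ χ₂ : Circle → Circle}
    (hg0 : ∀ p, g (0, p) = (χ₁ p.2, χ₂ p.1)) :
    ∃ G, T.IsFilling (H.torusMap fun p => g (1, p)) j Prod.swap G := by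
  obtain ⟨B, κ, c, hB, hbij, hB1, hB0⟩ := T.exists_isotopy_chainBlowUp_angles hn hHa hj hj' hne
  refine (T.chainBlowUp hn hHa hj hj' hne).exists_isFilling hj (hg.comp (by fun_prop)) (hgbij 1)
    (A := fun y => g (y.1, B (y.1, y.2.swap))) (χ₁ := χ₁ ∘ c) (χ₂ := χ₂ ∘ κ)
    (hg.comp (continuous_fst.prodMk (hB.comp
      (continuous_fst.prodMk (continuous_swap.comp continuous_snd)))))
    (fun t => (hgbij t).comp ((hbij t).comp Prod.swap_bijective))
    (fun p => by rw [← hB1]) fun p => ?_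
  rw [hB0, hg0]
  rfl

end ChainBlowUp

theorem realizes_torusSwap (T : TubeSystem K) {n k k' : ℕ} {H : HopfFrame} {j j' : ι} (hn : 2 ≤ n)
    (hHa : H.a = chainFun n k) (hHb : H.b = chainFun n k') (hj : K j = {x | H.a x = 0})
    (hj' : K j' = {x | H.b x = 0}) (hne : j ≠ j') :
    T.Realizes {j, j'} (H.torusMap (torusSwap 1)) := by
  have hg : Continuous fun y : unitInterval × (Circle × Circle) => torusSwap y.1 y.2 := by
    fun_prop
  refine ⟨HopfFrame.bijective_torusMap (bijective_torusSwap 1), ?_, ?_, ?_⟩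
  · refine (HopfFrame.continuousOn_torusMap (by fun_prop)).mono fun x hx => ?_
    rw [Set.biUnion_pair, hj, hj', Set.mem_compl_iff, Set.mem_union, not_or] at hx
    exact hx
  · rintro i (rfl | rfl)
    · exact HopfFrame.image_torusMap_of_eq_zero fun x hx => Or.inl (hj.subset hx)
    · exact HopfFrame.image_torusMap_of_eq_zero fun x hx => Or.inr (hj'.subset hx)
  · rintro i (rfl | rfl)
    · have hfill := T.exists_isFilling_torusMap hn hHa hj hj' hne hg
        (fun t => bijective_torusSwap t) (χ₁ := (·⁻¹)) (χ₂ := id) fun p => torusSwap_zero p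
      simpa only [Set.Icc.coe_one] using hfill
    · have hg' : Continuous fun y : unitInterval × (Circle × Circle) =>
          (torusSwap y.1 y.2.swap).swap := by
        fun_prop
      have hgbij' : ∀ t : unitInterval, Function.Bijective fun p : Circle × Circle =>
          (torusSwap t p.swap).swap :=
        fun t => Prod.swap_bijective.comp ((bijective_torusSwap t).comp Prod.swap_bijective)
      have hfill := T.exists_isFilling_torusMap hn (H := H.swap) hHb hj' hj hne.symm hg' hgbij'
        (χ₁ := id) (χ₂ := (·⁻¹)) fun p => by simp only [Set.Icc.coe_zero, torusSwap_zero]; rfl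
      have hswap : H.torusMap (torusSwap 1) =
          H.swap.torusMap fun p => (torusSwap 1 p.swap).swap :=
        funext fun x => (HopfFrame.torusMap_swap _ x).symm
      rw [hswap]
      simpa only [Set.Icc.coe_one] using hfill

end TubeSystem

theorem realizes_mlSwap {n : ℕ} (hn : 2 ≤ n) (i : ZMod (2 * n)) (T : TubeSystem (chainLink n)) :
    T.Realizes {i, i + 1} (mlSwap n i) := by
  have hne : i ≠ i + 1 := by
    have : Fact (1 < 2 * n) := ⟨by omega⟩
    simp
  rw [mlSwap_eq hn]
  exact T.realizes_torusSwap hn rfl rfl rfl (chainLink_add_one hn i) hne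

/-! ### Non-overlapping swaps -/

theorem re_mul_exp_neg_mul_I (z : ℂ) (θ : ℝ) :
    (z * Complex.exp (-(θ * Complex.I))).re = ‖z‖ * Real.cos (Complex.arg z - θ) := by
  have hpolar : z * Complex.exp (-(θ * Complex.I)) =
      ‖z‖ * Complex.exp (((Complex.arg z - θ : ℝ) : ℂ) * Complex.I) := by
    conv_lhs => rw [← Complex.norm_mul_exp_arg_mul_I z]
    rw [mul_assoc, ← Complex.exp_add]
    push_cast
    ring_nf
  rw [hpolar, Complex.re_ofReal_mul, Complex.exp_ofReal_mul_I_re]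

theorem exists_abs_sub_mul_two_pi_le {ρ φ : ℝ} (hρ : 0 ≤ ρ) (h : Real.cos ρ ≤ Real.cos φ) :
    ∃ m : ℤ, |φ - m * (2 * Real.pi)| ≤ ρ := by
  have hpi := Real.pi_pos
  refine ⟨round (φ / (2 * Real.pi)), ?_⟩
  set m := round (φ / (2 * Real.pi))
  have hm : |φ - m * (2 * Real.pi)| ≤ Real.pi := by
    have hround := abs_sub_round (φ / (2 * Real.pi))
    have hscale : φ - m * (2 * Real.pi) = (φ / (2 * Real.pi) - m) * (2 * Real.pi) := by field_simp
    rw [hscale, abs_mul, abs_of_pos (by positivity : 0 < 2 * Real.pi)]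
    nlinarith
  by_contra! hlt
  have hcos := Real.cos_lt_cos_of_nonneg_of_le_pi hρ hm hlt
  rw [Real.cos_abs, Real.cos_sub_int_mul_two_pi] at hcos
  linarith

theorem exists_abs_arg_sub_le_of_chainFun_re_nonneg {n : ℕ} (hn : 2 ≤ n) (k : ℕ) {x : S3}
    (hx : 0 ≤ (chainFun n k x).re) :
    ∃ m : ℤ, |Complex.arg ((x : C2) 0) * n / Real.pi - k - 2 * n * m| ≤ 3 / 4 := by
  have hn2 : (2 : ℝ) ≤ n := by exact_mod_cast hn
  have hn0 : (0 : ℝ) < n := by linarith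
  have hpi := Real.pi_pos
  set ρ := 3 * Real.pi / (4 * n) with hρ
  have hρ0 : 0 ≤ ρ := by positivity
  have hρ2 : ρ < Real.pi / 2 := by
    rw [hρ, div_lt_div_iff₀ (by positivity) (by positivity)]
    nlinarith
  have hcosρ : 0 < Real.cos ρ := Real.cos_pos_of_mem_Ioo ⟨by linarith, hρ2⟩
  set φ := Complex.arg ((x : C2) 0) - k * Real.pi / n with hφ
  have hre : (chainFun n k x).re = ‖(x : C2) 0‖ * Real.cos φ - Real.cos ρ := by
    rw [hφ, ← re_mul_exp_neg_mul_I]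
    simp only [chainFun]
    push_cast
    rfl
  have hnorm : ‖(x : C2) 0‖ ≤ 1 :=
    (PiLp.norm_apply_le (x : C2) 0).trans_eq (mem_sphere_zero_iff_norm.1 x.2)
  have hcos : Real.cos ρ ≤ Real.cos φ := by
    have hφ0 : 0 < Real.cos φ := pos_of_mul_pos_right (by linarith) (norm_nonneg ((x : C2) 0))
    nlinarith
  obtain ⟨m, hm⟩ := exists_abs_sub_mul_two_pi_le hρ0 hcos
  refine ⟨m, ?_⟩
  calc |Complex.arg ((x : C2) 0) * n / Real.pi - k - 2 * n * m|
      = |(φ - m * (2 * Real.pi)) * (n / Real.pi)| := by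
        rw [hφ]
        congr 1
        field_simp
    _ = |φ - m * (2 * Real.pi)| * (n / Real.pi) := by rw [abs_mul, abs_of_pos (div_pos hn0 hpi)]
    _ ≤ ρ * (n / Real.pi) := by gcongr
    _ = 3 / 4 := by rw [hρ]; field_simp

theorem exists_natCast_eq_add_of_chainFun_re_nonneg {n : ℕ} (hn : 2 ≤ n) {k l : ℕ} {x : S3}
    (hk : 0 ≤ (chainFun n k x).re) (hl : 0 ≤ (chainFun n l x).re) :
    ∃ N : ℤ, |N| ≤ 1 ∧ (k : ZMod (2 * n)) = l + N := by
  obtain ⟨m, hm⟩ := exists_abs_arg_sub_le_of_chainFun_re_nonneg hn k hk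
  obtain ⟨m', hm'⟩ := exists_abs_arg_sub_le_of_chainFun_re_nonneg hn l hl
  refine ⟨k - l + 2 * n * (m - m'), ?_, ?_⟩
  · have hlt : |((k - l + 2 * n * (m - m') : ℤ) : ℝ)| < 2 := by
      push_cast
      rw [abs_le] at hm hm'
      rw [abs_lt]
      constructor <;> linarith
    have hlt' : |(k - l + 2 * n * (m - m') : ℤ)| < 2 := by exact_mod_cast hlt
    omega
  · have hperiod : ((2 * n : ℕ) : ZMod (2 * n)) = 0 := ZMod.natCast_self _
    push_cast at hperiod ⊢
    rw [hperiod]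
    ring

theorem disjoint_chainLink {n : ℕ} (hn : 2 ≤ n) {j k : ZMod (2 * n)} (h : j ≠ k) :
    Disjoint (chainLink n j) (chainLink n k) := by
  have : NeZero (2 * n) := ⟨by omega⟩
  have hadj : ∀ (i : ZMod (2 * n)) (x : S3), x ∈ chainLink n i → x ∉ chainLink n (i + 1) := by
    intro i x hi hi'
    rw [chainLink_add_one hn] at hi'
    exact (chainFun_ne_zero hn i.val x).elim (fun hne => hne hi) fun hne => hne hi'
  have hre : ∀ (i : ZMod (2 * n)) (x : S3), x ∈ chainLink n i → 0 ≤ (chainFun n i.val x).re :=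
    fun i x hi => (congrArg Complex.re (show chainFun n i.val x = 0 from hi)).ge
  rw [Set.disjoint_left]
  intro x hj hk
  obtain ⟨N, hN, hjk⟩ := exists_natCast_eq_add_of_chainFun_re_nonneg hn (hre j x hj) (hre k x hk)
  simp only [ZMod.natCast_val, ZMod.cast_id', id] at hjk
  rw [abs_le] at hN
  obtain rfl | rfl | rfl : N = -1 ∨ N = 0 ∨ N = 1 := by omega
  · exact hadj j x hj (by rwa [show j + 1 = k by rw [hjk]; push_cast; ring])
  · exact h (by simpa using hjk)
  · exact hadj k x hk (by rwa [show k + 1 = j by rw [hjk]; push_cast; ring])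

/-- A closed set outside of which the `i`-th `ml`-swap is the identity: the points at which the
function of `K i` or that of `K (i + 1)` has nonnegative real part. -/
def swapRegion (n : ℕ) (i : ZMod (2 * n)) : Set S3 :=
  {x | ∃ a ≤ 1, 0 ≤ (chainFun n (i.val + a) x).re}

theorem mlSwap_of_notMem_swapRegion {n : ℕ} (hn : 2 ≤ n) {i : ZMod (2 * n)} {x : S3}
    (hx : x ∉ swapRegion n i) : mlSwap n i x = x := by
  simp only [swapRegion, Set.mem_ofPred_eq, not_exists, not_and, not_le] at hx
  exact mlSwap_of_re_nonpos hn i (hx 0 zero_le_one).le (hx 1 le_rfl).le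

theorem chainLink_subset_swapRegion {n : ℕ} (hn : 2 ≤ n) {i k : ZMod (2 * n)}
    (hk : k = i ∨ k = i + 1) : chainLink n k ⊆ swapRegion n i := by
  intro x hx
  rcases hk with rfl | rfl
  · exact ⟨0, zero_le_one, (congrArg Complex.re (show chainFun n k.val x = 0 from hx)).ge⟩
  · rw [chainLink_add_one hn] at hx
    exact ⟨1, le_rfl, (congrArg Complex.re (show chainFun n (i.val + 1) x = 0 from hx)).ge⟩

theorem NonOverlapping.disjoint_swapRegion {n : ℕ} (hn : 2 ≤ n) {i j : ZMod (2 * n)}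
    (h : NonOverlapping n i j) : Disjoint (swapRegion n i) (swapRegion n j) := by
  have : NeZero (2 * n) := ⟨by omega⟩
  rw [Set.disjoint_left]
  rintro x ⟨a, ha, hxa⟩ ⟨b, hb, hxb⟩
  obtain ⟨N, hN, hab⟩ := exists_natCast_eq_add_of_chainFun_re_nonneg hn hxa hxb
  push_cast at hab
  simp only [ZMod.natCast_val, ZMod.cast_id', id] at hab
  have hij : i - j = ((b - a + N : ℤ) : ZMod (2 * n)) := by
    push_cast
    linear_combination hab
  have hmin := ZMod.natAbs_min_of_le_div_two (2 * n) (i - j).valMinAbs (b - a + N)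
    (by rw [ZMod.coe_valMinAbs, hij]) (ZMod.natAbs_valMinAbs_le _)
  have hfour : 4 ≤ (i - j).valMinAbs.natAbs := h
  rw [abs_le] at hN
  omega

theorem NonOverlapping.symm {n : ℕ} {i j : ZMod (2 * n)} (h : NonOverlapping n i j) :
    NonOverlapping n j i := by
  rwa [NonOverlapping, ← neg_sub, ZMod.natAbs_valMinAbs_neg]

theorem NonOverlapping.mlSwap_comm {n : ℕ} (hn : 2 ≤ n) {i j : ZMod (2 * n)}
    (h : NonOverlapping n i j) : mlSwap n i ∘ mlSwap n j = mlSwap n j ∘ mlSwap n i := by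
  have hdisj : Equiv.Perm.Disjoint (Equiv.ofBijective _ (bijective_mlSwap hn i))
      (Equiv.ofBijective _ (bijective_mlSwap hn j)) := fun x => by
    by_cases hx : x ∈ swapRegion n i
    · exact Or.inr (mlSwap_of_notMem_swapRegion hn
        (Set.disjoint_left.1 (h.disjoint_swapRegion hn) hx))
    · exact Or.inl (mlSwap_of_notMem_swapRegion hn hx)
  exact congrArg DFunLike.coe hdisj.commute.eq

theorem NonOverlapping.eqOn_mlSwap_id {n : ℕ} (hn : 2 ≤ n) {i j k : ZMod (2 * n)}
    (h : NonOverlapping n i j) (hk : k = j ∨ k = j + 1) :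
    Set.EqOn (mlSwap n i) id (chainLink n k) := fun _ hx =>
  mlSwap_of_notMem_swapRegion hn (Set.disjoint_right.1 (h.disjoint_swapRegion hn)
    (chainLink_subset_swapRegion hn hk hx))

theorem mlSwaps_cons (n : ℕ) (i : ZMod (2 * n)) (l : List (ZMod (2 * n))) :
    mlSwaps n (i :: l) = mlSwap n i ∘ mlSwaps n l := rfl

theorem eqOn_mlSwaps_id {n : ℕ} {l : List (ZMod (2 * n))} {A : Set S3}
    (h : ∀ j ∈ l, Set.EqOn (mlSwap n j) id A) : Set.EqOn (mlSwaps n l) id A := by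
  induction l with
  | nil => exact fun _ _ => rfl
  | cons j l ih =>
    intro x hx
    rw [mlSwaps_cons, Function.comp_apply, ih (fun j hj => h j (List.mem_cons_of_mem _ hj)) hx]
    exact h j List.mem_cons_self hx

theorem mlSwap_comp_mlSwaps_comm {n : ℕ} (hn : 2 ≤ n) {i : ZMod (2 * n)}
    {l : List (ZMod (2 * n))} (h : ∀ j ∈ l, NonOverlapping n i j) :
    mlSwap n i ∘ mlSwaps n l = mlSwaps n l ∘ mlSwap n i := by
  induction l with
  | nil => rfl
  | cons j l ih =>
    rw [mlSwaps_cons, ← Function.comp_assoc, (h j List.mem_cons_self).mlSwap_comm hn,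
      Function.comp_assoc, ih fun j hj => h j (List.mem_cons_of_mem _ hj), Function.comp_assoc]

theorem hopfSublink_nil (n : ℕ) : hopfSublink n [] = ∅ := by
  simp [hopfSublink]

theorem hopfSublink_cons (n : ℕ) (i : ZMod (2 * n)) (l : List (ZMod (2 * n))) :
    hopfSublink n (i :: l) = {i, i + 1} ∪ hopfSublink n l := by
  ext k
  simp [hopfSublink]

theorem nonempty_chainLink {n : ℕ} (hn : 2 ≤ n) (k : ZMod (2 * n)) : (chainLink n k).Nonempty :=
  ⟨_, (chainFrame hn k.val).range_inv_zero_circle.subset ⟨1, rfl⟩⟩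

theorem disjoint_hopfSublink {n : ℕ} (hn : 2 ≤ n) {i : ZMod (2 * n)} {l : List (ZMod (2 * n))}
    (h : ∀ j ∈ l, NonOverlapping n i j) : Disjoint {i, i + 1} (hopfSublink n l) := by
  rw [Set.disjoint_left]
  rintro k hki ⟨j, hj, hkj⟩
  obtain ⟨x, hx⟩ := nonempty_chainLink hn k
  exact Set.disjoint_left.1 ((h j hj).disjoint_swapRegion hn)
    (chainLink_subset_swapRegion hn hki hx) (chainLink_subset_swapRegion hn hkj hx)

theorem realizes_mlSwaps {n : ℕ} (hn : 2 ≤ n) (T : TubeSystem (chainLink n))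
    {l : List (ZMod (2 * n))} (hl : l.Pairwise (NonOverlapping n)) :
    T.Realizes (hopfSublink n l) (mlSwaps n l) := by
  induction l with
  | nil =>
    rw [hopfSublink_nil]
    exact T.realizes_empty
  | cons i l ih =>
    obtain ⟨hi, hl⟩ := List.pairwise_cons.1 hl
    rw [hopfSublink_cons, mlSwaps_cons]
    refine (realizes_mlSwap hn i T).comp (ih hl) (disjoint_hopfSublink hn hi)
      (mlSwap_comp_mlSwaps_comm hn hi) ?_ ?_
    · rintro k ⟨j, hj, hkj⟩
      exact ((hi j hj).eqOn_mlSwap_id hn hkj).image_eq_self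
    · exact fun k hk => (eqOn_mlSwaps_id fun j hj =>
        (hi j hj).symm.eqOn_mlSwap_id hn hk).image_eq_self

/-! ### Explicit tubes around the components of the chain -/

theorem injective_fderiv_of_hasFDerivAt_comp {E F G : Type*} [NormedAddCommGroup E]
    [NormedSpace ℝ E] [NormedAddCommGroup F] [NormedSpace ℝ F] [NormedAddCommGroup G]
    [NormedSpace ℝ G] {f : E → F} {g : F → G} {L : E →L[ℝ] G} {y : E}
    (hf : DifferentiableAt ℝ f y) (hg : DifferentiableAt ℝ g (f y))
    (hL : HasFDerivAt (g ∘ f) L y) (hinj : Function.Injective L) :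
    Function.Injective (fderiv ℝ f y) := by
  rw [hL.unique (hg.hasFDerivAt.comp y hf.hasFDerivAt)] at hinj
  exact Function.Injective.of_comp hinj

theorem nullHomologousIn_of_extend {U : Set S3} {F : Disk → S3} (hF : Continuous F)
    (hU : ∀ y, F y ∈ U) : NullHomologousIn U fun v => F (diskBoundary v) := by
  have : ContractibleSpace Disk :=
    (convex_closedBall (0 : ℂ) 1).contractibleSpace ⟨0, by simp⟩
  let F' : C(Disk, U) := ⟨fun y => ⟨F y, hU y⟩, hF.subtype_mk _⟩
  let boundary : Path (diskBoundary 1) (diskBoundary 1) :=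
    { toFun := fun t => diskBoundary (Circle.exp (2 * Real.pi * t))
      continuous_toFun := Continuous.subtype_mk (by fun_prop) _
      source' := by simp
      target' := by simp }
  refine ⟨F' (diskBoundary 1), boundary.map F'.continuous, fun t => rfl, ?_⟩
  have hnull : (boundary.map F'.continuous).Homotopic (Path.refl _) :=
    (SimplyConnectedSpace.paths_homotopic boundary (Path.refl _)).map F'
  rw [Path.Homotopic.Quotient.eq.2 hnull]
  exact map_one _

theorem exists_pos_disjoint_image_closedBall_prod {ι E C Y : Type*} [Finite ι]
    [SeminormedAddCommGroup E] [TopologicalSpace C] [CompactSpace C] [TopologicalSpace Y]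
    [T2Space Y] {f : ι → E × C → Y} (hf : ∀ j, Continuous (f j))
    (hdisj : ∀ j k, j ≠ k → ∀ v w, f j (0, v) ≠ f k (0, w)) :
    ∃ ε > 0, ∀ j k, j ≠ k → Disjoint (f j '' (Metric.closedBall 0 ε ×ˢ Set.univ))
      (f k '' (Metric.closedBall 0 ε ×ˢ Set.univ)) := by
  have hev : ∀ᶠ p : E × E in nhds 0, ∀ j k, j ≠ k → ∀ c : C × C,
      f j (p.1, c.1) ≠ f k (p.2, c.2) := by
    simp only [Filter.eventually_all]
    intro j k hjk
    have hopen : IsOpen {z : (E × E) × (C × C) | f j (z.1.1, z.2.1) ≠ f k (z.1.2, z.2.2)} :=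
      isOpen_ne_fun ((hf j).comp (by fun_prop)) ((hf k).comp (by fun_prop))
    have hall := IsCompact.eventually_forall_of_forall_eventually (x₀ := (0 : E × E))
      (P := fun p c => f j (p.1, c.1) ≠ f k (p.2, c.2)) (isCompact_univ (X := C × C))
      fun c _ => hopen.mem_nhds (hdisj j k hjk c.1 c.2)
    simpa only [Set.mem_univ, forall_const] using hall
  obtain ⟨δ, hδ, hball⟩ := Metric.eventually_nhds_iff.1 hev
  refine ⟨δ / 2, half_pos hδ, fun j k hjk => Set.disjoint_left.2 ?_⟩
  rintro _ ⟨⟨u, v⟩, ⟨hu, -⟩, rfl⟩ ⟨⟨u', v'⟩, ⟨hu', -⟩, heq⟩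
  refine hball (y := (u, u')) ?_ j k hjk (v, v') heq.symm
  rw [dist_zero_right, Prod.norm_mk]
  exact (max_le (mem_closedBall_zero_iff.1 hu) (mem_closedBall_zero_iff.1 hu')).trans_lt
    (half_lt_self hδ)

/-- The sine of the angular radius of the components of the chain. -/
def chainSin (n : ℕ) : ℝ := Real.sin (3 * Real.pi / (4 * n))

theorem chainSin_sq_add_chainCos_sq (n : ℕ) : chainSin n ^ 2 + chainCos n ^ 2 = 1 :=
  Real.sin_sq_add_cos_sq _

theorem chainCos_pos_and_chainSin_pos {n : ℕ} (hn : 2 ≤ n) : 0 < chainCos n ∧ 0 < chainSin n := by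
  have hn2 : (2 : ℝ) ≤ n := by exact_mod_cast hn
  have hpi := Real.pi_pos
  have hpos : 0 < 3 * Real.pi / (4 * n) := by positivity
  have hlt : 3 * Real.pi / (4 * n) < Real.pi / 2 := by
    rw [div_lt_div_iff₀ (by positivity) (by positivity)]
    nlinarith
  exact ⟨Real.cos_pos_of_mem_Ioo ⟨by linarith, hlt⟩,
    Real.sin_pos_of_pos_of_lt_pi hpos (by linarith)⟩

/-- The point of `ℂ²` with given coordinates `(p, q)` with respect to the `k`-th component. -/
def chainPoint (n k : ℕ) (y : ℂ × ℂ) : C2 := (chainCoord n k).symm !₂[y.1, y.2]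

theorem norm_sq_chainPoint (n k : ℕ) (y : ℂ × ℂ) :
    ‖chainPoint n k y‖ ^ 2 = ‖y.1‖ ^ 2 + ‖y.2‖ ^ 2 := by
  rw [chainPoint, LinearIsometryEquiv.norm_map, EuclideanSpace.norm_sq_eq, Fin.sum_univ_two]
  rfl

theorem chainPoint_ne_zero (n k : ℕ) {y : ℂ × ℂ} (hy : y ≠ 0) : chainPoint n k y ≠ 0 := by
  contrapose! hy
  have hsq := norm_sq_chainPoint n k y
  rw [hy, norm_zero, zero_pow two_ne_zero] at hsq
  exact Prod.ext (norm_eq_zero.1 (by nlinarith [sq_nonneg ‖y.1‖, sq_nonneg ‖y.2‖]))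
    (norm_eq_zero.1 (by nlinarith [sq_nonneg ‖y.1‖, sq_nonneg ‖y.2‖]))

theorem contDiff_chainPoint (n k : ℕ) : ContDiff ℝ ∞ (chainPoint n k) := by
  refine (chainCoord n k).symm.contDiff.comp (contDiff_piLp 2 |>.2 fun i => ?_)
  fin_cases i
  · exact contDiff_fst
  · exact contDiff_snd

/-- The radial projection to `S³` of the point with coordinates `(p, q)` with respect to the `k`-th
component. -/
def chainRay (n k : ℕ) (y : ({0}ᶜ : Set (ℂ × ℂ))) : S3 :=
  ⟨‖chainPoint n k y‖⁻¹ • chainPoint n k y, mem_sphere_zero_iff_norm.2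
    (norm_smul_inv_norm (𝕜 := ℝ) (chainPoint_ne_zero n k y.2))⟩

theorem continuous_chainRay (n k : ℕ) : Continuous (chainRay n k) := by
  have hpoint : Continuous fun y : ({0}ᶜ : Set (ℂ × ℂ)) => chainPoint n k y :=
    (contDiff_chainPoint n k).continuous.comp continuous_subtype_val
  exact ((hpoint.norm.inv₀ fun y => norm_ne_zero_iff.2 (chainPoint_ne_zero n k y.2)).smul
    hpoint).subtype_mk _

theorem chainCoord_chainRay (n k : ℕ) (y : ({0}ᶜ : Set (ℂ × ℂ))) :
    chainCoord n k (chainRay n k y) = ‖chainPoint n k y‖⁻¹ • !₂[y.1.1, y.1.2] := by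
  simp only [chainRay, chainPoint, map_smul, LinearIsometryEquiv.apply_symm_apply]

theorem chainRay_eq_of_chainCoord_eq {n k : ℕ} {x : S3} {y : ({0}ᶜ : Set (ℂ × ℂ))}
    (hx : chainCoord n k x = !₂[y.1.1, y.1.2]) : chainRay n k y = x := by
  have hpoint : chainPoint n k y = x := by
    rw [chainPoint, ← hx, LinearIsometryEquiv.symm_apply_apply]
  refine Subtype.ext ?_
  change ‖chainPoint n k y‖⁻¹ • chainPoint n k y = (x : C2)
  rw [hpoint, mem_sphere_zero_iff_norm.1 x.2, inv_one, one_smul]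

section

variable {n : ℕ} (hn : 2 ≤ n) (k : ℕ) (ε : ℝ)

/-- The coordinates of the tube of radius `ε` around the circle `p = chainCos n`,
`‖q‖ = chainSin n`, before the radial projection to `S³`. -/
def tubeCoord (y : ℂ × Circle) : ({0}ᶜ : Set (ℂ × ℂ)) :=
  ⟨(chainCos n + ε * y.1, chainSin n * y.2), fun h => y.2.coe_ne_zero
    ((mul_eq_zero.1 (congrArg Prod.snd h)).resolve_left
      (Complex.ofReal_ne_zero.2 (chainCos_pos_and_chainSin_pos hn).2.ne'))⟩

/-- The tube of radius `ε` around the `k`-th component. -/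
def chainTube (y : ℂ × Circle) : S3 := chainRay n k (tubeCoord hn ε y)

theorem continuous_chainTube : Continuous (chainTube hn k ε) :=
  (continuous_chainRay n k).comp (Continuous.subtype_mk (by fun_prop) _)

theorem contDiff_chainTube :
    ContDiff ℝ ∞ fun y : ℂ × ℝ => (chainTube hn k ε (y.1, Circle.exp y.2) : C2) := by
  have hexp : ContDiff ℝ ∞ fun y : ℂ × ℝ => (Circle.exp y.2 : ℂ) := by
    simp only [Circle.coe_exp]
    exact ((Complex.ofRealCLM.contDiff.comp contDiff_snd).mul contDiff_const).cexp
  have hpoint := (contDiff_chainPoint n k).comp <|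
    (contDiff_const (c := (chainCos n : ℂ)).add (contDiff_const (c := (ε : ℂ)).mul
      contDiff_fst)).prodMk (contDiff_const (c := (chainSin n : ℂ)).mul hexp)
  have hne (y : ℂ × ℝ) : chainPoint n k (tubeCoord hn ε (y.1, Circle.exp y.2)) ≠ 0 :=
    chainPoint_ne_zero n k (tubeCoord hn ε _).2
  exact ((hpoint.norm ℝ hne).inv fun y => norm_ne_zero_iff.2 (hne y)).smul hpoint

/-- The homogeneous functions `p / ‖q‖` and `q / ‖q‖` of the coordinates with respect to the `k`-th
component, which recover the parameters of a tube. -/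
def coordRatio (n k : ℕ) (x : C2) : ℂ × ℂ :=
  (‖chainCoord n k x 1‖⁻¹ • chainCoord n k x 0, ‖chainCoord n k x 1‖⁻¹ • chainCoord n k x 1)

theorem coordRatio_smul {s : ℝ} (hs : 0 < s) (x : C2) :
    coordRatio n k (s • x) = coordRatio n k x := by
  simp only [coordRatio, map_smul, PiLp.smul_apply, norm_smul, Real.norm_of_nonneg hs.le,
    smul_smul, mul_inv_rev, inv_mul_cancel_right₀ hs.ne']

theorem differentiableAt_coordRatio {x : C2} (hx : chainCoord n k x 1 ≠ 0) :
    DifferentiableAt ℝ (coordRatio n k) x := by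
  have hcoord (i : Fin 2) : DifferentiableAt ℝ (fun x => chainCoord n k x i) x :=
    differentiableAt_piLp 2 |>.1 (chainCoord n k).differentiableAt i
  have hinv := ((hcoord 1).norm ℝ hx).inv (norm_ne_zero_iff.2 hx)
  exact (hinv.smul (hcoord 0)).prodMk (hinv.smul (hcoord 1))

theorem chainCoord_chainTube_ne_zero (y : ℂ × Circle) :
    chainCoord n k (chainTube hn k ε y) 1 ≠ 0 := by
  rw [chainTube, chainCoord_chainRay]
  exact smul_ne_zero (inv_ne_zero (norm_ne_zero_iff.2
    (chainPoint_ne_zero n k (tubeCoord hn ε y).2)))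
    (mul_ne_zero (Complex.ofReal_ne_zero.2 (chainCos_pos_and_chainSin_pos hn).2.ne')
      y.2.coe_ne_zero)

theorem coordRatio_chainTube (y : ℂ × Circle) : coordRatio n k (chainTube hn k ε y) =
    ((chainSin n)⁻¹ • (chainCos n + ε * y.1 : ℂ), (y.2 : ℂ)) := by
  have hsin := (chainCos_pos_and_chainSin_pos hn).2
  have hpos : 0 < ‖chainPoint n k (tubeCoord hn ε y)‖⁻¹ :=
    inv_pos.2 (norm_pos_iff.2 (chainPoint_ne_zero n k (tubeCoord hn ε y).2))
  change coordRatio n k (‖chainPoint n k (tubeCoord hn ε y)‖⁻¹ • chainPoint n k _) = _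
  rw [coordRatio_smul k hpos]
  simp [coordRatio, chainPoint, tubeCoord, Circle.norm_coe, abs_of_pos hsin, hsin.ne']

theorem injective_chainTube {ε : ℝ} (hε : 0 < ε) : Function.Injective (chainTube hn k ε) := by
  intro y y' h
  have hratio := coordRatio_chainTube hn k ε y
  rw [h, coordRatio_chainTube, Prod.mk.injEq] at hratio
  have hfst := smul_right_injective ℂ (inv_ne_zero (chainCos_pos_and_chainSin_pos hn).2.ne')
    hratio.1
  exact Prod.ext (mul_left_cancel₀ (Complex.ofReal_ne_zero.2 hε.ne') (add_left_cancel hfst)).symm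
    (Circle.ext hratio.2.symm)

theorem immersion_chainTube {ε : ℝ} (hε : 0 < ε) (y : ℂ × ℝ) : Function.Injective
    (fderiv ℝ (fun y : ℂ × ℝ => (chainTube hn k ε (y.1, Circle.exp y.2) : C2)) y) := by
  have hcomp : (coordRatio n k ∘ fun y : ℂ × ℝ => (chainTube hn k ε (y.1, Circle.exp y.2) : C2)) =
      fun y => ((chainSin n)⁻¹ • (chainCos n + ε * y.1 : ℂ), Complex.exp (y.2 * Complex.I)) :=
    funext fun y => (coordRatio_chainTube hn k ε _).trans (by rw [Circle.coe_exp])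
  have hfst : HasFDerivAt (fun y : ℂ × ℝ => (chainSin n)⁻¹ • (chainCos n + ε * y.1 : ℂ)) _ y :=
    (((ContinuousLinearMap.fst ℝ ℂ ℝ).hasFDerivAt.const_mul (ε : ℂ)).const_add
      (chainCos n : ℂ)).const_smul (chainSin n)⁻¹
  have hsnd : HasFDerivAt (fun y : ℂ × ℝ => Complex.exp (y.2 * Complex.I)) _ y :=
    ((Complex.ofRealCLM.hasFDerivAt.comp y hasFDerivAt_snd).mul_const Complex.I).cexp
  refine injective_fderiv_of_hasFDerivAt_comp
    ((contDiff_chainTube hn k ε).differentiable (by simp)).differentiableAt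
    (differentiableAt_coordRatio k (chainCoord_chainTube_ne_zero hn k ε _))
    (hcomp ▸ hfst.prodMk hsnd) ((injective_iff_map_eq_zero _).2 ?_)
  rintro ⟨a, τ⟩ h
  obtain ⟨ha, hτ⟩ := Prod.mk.inj h
  have hsin := (chainCos_pos_and_chainSin_pos hn).2.ne'
  exact Prod.ext (by simpa [hsin, hε.ne'] using ha) (by simpa using hτ)

theorem range_chainTube_core :
    Set.range (fun v : Circle => chainTube hn k ε (0, v)) = {x | chainFun n k x = 0} := by
  have hsin := (chainCos_pos_and_chainSin_pos hn).2
  have htrig := chainSin_sq_add_chainCos_sq n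
  simp only [Set.ext_iff, Set.mem_range, Set.mem_ofPred_eq, chainFun_eq, sub_eq_zero]
  refine fun x => ⟨?_, fun hx => ⟨dir (chainCoord n k x 1), chainRay_eq_of_chainCoord_eq ?_⟩⟩
  · rintro ⟨v, rfl⟩
    have hnorm : ‖chainPoint n k (tubeCoord hn ε (0, v))‖ = 1 := by
      rw [← pow_eq_one_iff_of_nonneg (norm_nonneg _) two_ne_zero, norm_sq_chainPoint]
      simpa [tubeCoord, Circle.norm_coe, add_comm] using htrig
    rw [chainTube, chainCoord_chainRay, hnorm]
    simp [tubeCoord]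
  · have hsq := norm_sq_chainCoord n k x
    rw [hx, Complex.norm_real, Real.norm_eq_abs, sq_abs] at hsq
    have hnorm : ‖chainCoord n k x 1‖ = chainSin n :=
      (pow_left_inj₀ (norm_nonneg _) hsin.le two_ne_zero).1 (by linarith)
    ext i
    fin_cases i
    · simpa [tubeCoord] using hx
    · simpa [tubeCoord, hnorm] using (norm_smul_dir (chainCoord n k x 1)).symm

theorem nullHomologousIn_chainTube {ε : ℝ} (hε : 0 < ε) :
    NullHomologousIn {x | chainFun n k x = 0}ᶜ fun v => chainTube hn k ε (1, v) := by
  obtain ⟨hcos, hsin⟩ := chainCos_pos_and_chainSin_pos hn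
  have htrig := chainSin_sq_add_chainCos_sq n
  have hne (z : ℂ) : ((chainCos n + ε * 1, chainSin n * z) : ℂ × ℂ) ≠ 0 := fun h => by
    have hsum : chainCos n + ε = 0 := by
      simpa using congrArg Complex.re (congrArg Prod.fst h)
    linarith
  let F (z : Disk) : S3 := chainRay n k ⟨_, hne z⟩
  refine nullHomologousIn_of_extend (F := F)
    ((continuous_chainRay n k).comp (Continuous.subtype_mk (by fun_prop) _)) fun z hz => ?_
  rw [Set.mem_ofPred_eq, chainFun_eq, sub_eq_zero, chainCoord_chainRay] at hz
  set N := ‖chainPoint n k (chainCos n + ε * 1, chainSin n * z)‖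
  have hN : N ^ 2 = (chainCos n + ε) ^ 2 + (chainSin n * ‖(z : ℂ)‖) ^ 2 := by
    rw [norm_sq_chainPoint, mul_one, ← Complex.ofReal_add, norm_mul, Complex.norm_real,
      Complex.norm_real, mul_pow, Real.norm_eq_abs, Real.norm_eq_abs, sq_abs, sq_abs, mul_pow]
  have hre : N⁻¹ * (chainCos n + ε) = chainCos n := by
    simpa [mul_add] using congrArg Complex.re hz
  have hzle : (chainSin n * ‖(z : ℂ)‖) ^ 2 ≤ chainSin n ^ 2 :=
    pow_le_pow_left₀ (by positivity)
      (mul_le_of_le_one_right hsin.le (mem_closedBall_zero_iff.1 z.2)) 2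
  have hNpos : N ≠ 0 := by
    intro h0
    rw [h0] at hN
    nlinarith
  have hscale : (chainCos n + ε) ^ 2 = chainCos n ^ 2 * N ^ 2 := by
    rw [← mul_pow, (inv_mul_eq_iff_eq_mul₀ hNpos).1 hre, mul_comm]
  have hle : (chainCos n + ε) ^ 2 * chainSin n ^ 2 ≤ chainCos n ^ 2 * chainSin n ^ 2 := by
    nlinarith [mul_le_mul_of_nonneg_left hzle (sq_nonneg (chainCos n))]
  have := pow_lt_pow_left₀ (lt_add_of_pos_right (chainCos n) hε) hcos.le two_ne_zero
  exact hle.not_gt (mul_lt_mul_of_pos_right this (pow_pos hsin 2))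

theorem chainTube_eq (y : ℂ × Circle) :
    chainTube hn k ε y = chainTube hn k 1 (ε * y.1, y.2) := by
  simp [chainTube, tubeCoord]

end

theorem nonempty_tubeSystem {n : ℕ} (hn : 2 ≤ n) : Nonempty (TubeSystem (chainLink n)) := by
  have : NeZero (2 * n) := ⟨by omega⟩
  have hcore (j : ZMod (2 * n)) (v : Circle) : chainTube hn j.val 1 (0, v) ∈ chainLink n j :=
    (range_chainTube_core hn j.val 1).subset ⟨v, rfl⟩
  obtain ⟨ε, hε, hdisj⟩ := exists_pos_disjoint_image_closedBall_prod
    (fun j : ZMod (2 * n) => continuous_chainTube hn j.val 1) fun j k hjk v w heq =>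
      Set.disjoint_left.1 (disjoint_chainLink hn hjk) (hcore j v) (heq ▸ hcore k w)
  have himage (j : ZMod (2 * n)) : chainTube hn j.val ε '' (Metric.closedBall 0 1 ×ˢ Set.univ) ⊆
      chainTube hn j.val 1 '' (Metric.closedBall 0 ε ×ˢ Set.univ) := by
    rintro _ ⟨y, ⟨hy, -⟩, rfl⟩
    refine ⟨(ε * y.1, y.2), ⟨?_, trivial⟩, (chainTube_eq hn j.val ε y).symm⟩
    rw [mem_closedBall_zero_iff] at hy ⊢
    simpa [abs_of_pos hε] using mul_le_of_le_one_right hε.le hy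
  exact ⟨{
    tube := fun j => chainTube hn j.val ε
    smooth := fun j => contDiff_chainTube hn j.val ε
    immersion := fun j => immersion_chainTube hn j.val hε
    injective := fun j => injective_chainTube hn j.val hε
    core := fun j => range_chainTube_core hn j.val ε
    disjoint := fun j k hjk => (hdisj j k hjk).mono (himage j) (himage k)
    preferred := fun j => nullHomologousIn_chainTube hn j.val hε }⟩

end

theorem mainTheorem10 (n : ℕ) (hn : 2 ≤ n) :
    Nonempty (TubeSystem (chainLink n)) ∧
    (∀ (i : ZMod (2 * n)) (T : TubeSystem (chainLink n)),
      ∃ F : T.Surgery {i, i + 1} ≃ₜ S3,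
        (∀ x : T.exterior, F (T.ofExterior {i, i + 1} x) = mlSwap n i x) ∧
        ∀ j, F '' T.coreLink {i, i + 1} j = mlSwap n i '' chainLink n j) ∧
    (∀ (l : List (ZMod (2 * n))) (L : ZMod (2 * n) → Set S3), IsNestedPartner n l L →
      ∀ T : TubeSystem (chainLink n),
        ∃ (F : T.Surgery (hopfSublink n l) ≃ₜ S3) (Φ : S3 ≃ₜ S3), IsotopicToId Φ ∧
          (∀ x : T.exterior, F (T.ofExterior (hopfSublink n l) x) = Φ (mlSwaps n l x)) ∧
          ∀ j, F '' T.coreLink (hopfSublink n l) j = L j) := by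
  have : NeZero (2 * n) := ⟨by omega⟩
  refine ⟨nonempty_tubeSystem hn, fun i T => (realizes_mlSwap hn i T).exists_homeomorph, ?_⟩
  rintro l L ⟨hl, Φ, hΦ, hL⟩ T
  obtain ⟨F, hext, hcore⟩ := (realizes_mlSwaps hn T hl).exists_homeomorph
  refine ⟨F.trans Φ, Φ, hΦ, fun x => congrArg Φ (hext x), fun j => ?_⟩
  exact (Set.image_comp Φ F _).trans ((congrArg (Φ '' ·) (hcore j)).trans (hL j))
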